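/- **Conventions.** Manifolds are smooth, connected, non-empty and without boundary; metrics and foliations are smooth. A compact Riemannian manifold $(M,g)$ carries its Riemannian distance, and $d_{\rm GH}$ is the Gromov–Hausdorff distance. For a metric space $X$ and $r>0$ let $\mathrm{Cap}_r(X)$ be the largest number of pairwise disjoint open balls of radius $r$ in $X$. A metric space $X'$ is *broader* than $X$, written $X'\succeq X$, if $\mathrm{Cap}_\delta(X')\ge \mathrm{Cap}_\delta(X)$ for all $\delta>0$. A foliation is *compact Hausdorff* if all its leaves are compact and its space of leaves $M/\mathcal F$, with the quotient topology, is Hausdorff. A leaf $L$ carries the distance and the volume of the Riemannian metric induced by $g$, and $B_L(x,\epsilon)$ denotes a ball for this distance. The space of leaves carries $$\rho(L,L')=\inf\Big\{\sum_{i=1}^{m-1}\mathrm{dist}(L_i,L_{i+1}) : L_1=L,\ L_m=L'\Big\},$$ the infimum over all finite sequences of leaves, where $\mathrm{dist}(L_i,L_{i+1})=\inf\{d(x,y):x\in L_i,\ y\in L_{i+1}\}$. A foliation is *Riemannian* for a metric $\tilde g$ if $\tilde g$ is bundle-like, i.e. locally the restriction of $\tilde g$ to the orthogonal complement of the leaves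 is the pull-back of a metric on the local space of leaves. **The class $\mathcal M(d,C,p,n)$.** For $d>0$, $C\ge 1$ it consists of all compact $n$-dimensional Riemannian manifolds with a compact Hausdorff foliation of dimension $p$, $(M,\mathcal F,g)$, such that 1. for every leaf $L$, all $x,y\in L$ and every $\epsilon<d$: if $B_L(x,\epsilon)$ and $B_L(y,\epsilon)$ are disjoint in $L$, then $B(x,\epsilon)$ and $B(y,\epsilon)$ are disjoint in $M$; 2. for every leaf $L$ there are constants $1\le C_L\le C$ and $\theta_L\ge 1/C$ with $$\frac{1}{C_L r^p}\,\mathrm{vol}(L)\le \mathrm{Cap}_r(L)\le \frac{C_L}{r^p}\,\mathrm{vol}(L)\qquad(0<r<\theta_L),$$ and there are constants $1\le C_M\le C$ and $\theta_M\ge 1/C$ with $$\frac{1}{C_M r^n}\,\mathrm{vol}(M)\le \mathrm{Cap}_r(M)\le \frac{C_M}{r^n}\,\mathrm{vol}(M)\qquad(0<r<\theta_M);$$ 3. $\frac1C\le \mathrm{vol}(L)\le C$ for every leaf $L$; 4. there is a Riemannian metric $\tilde g$ on $M$ with $\frac1C g\le\tilde g\le Cg$ for which $\mathcal F$ is a Riemannian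 foliation. **Theorem (GH-separation Theorem).** Let $d>0$, $C\ge1$, and let $p,p',n,n'$ be natural numbers with $p'>p$ and $n'\ge n$. There is $\epsilon>0$ such that for all $(M,\mathcal F,g)\in\mathcal M(d,C,p,n)$ and $(M',\mathcal F',g')\in\mathcal M(d,C,p',n')$ with $(M'/\mathcal F',\rho')\succeq(M/\mathcal F,\rho)$, $$d_{\rm GH}(M,M')>\epsilon .$$ -/

import Mathlib

open scoped Manifold ContDiff Topology ENNReal
open Bundle

noncomputable section

/-! ### Balls and capacity -/

/-- The open ball of radius `r` around `x` for a distance function `e`. -/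
def eBall {X : Type*} (e : X → X → ℝ≥0∞) (x : X) (r : ℝ) : Set X :=
  {y | e x y < ENNReal.ofReal r}

/-- The capacity `Cap_r(X)`: the largest number of pairwise disjoint open `r`-balls in `(X, e)`.
The finite set `s` is the set of centres. -/
def capacity {X : Type*} (e : X → X → ℝ≥0∞) (r : ℝ) : ℕ∞ :=
  ⨆ (s : Finset X) (_ : (s : Set X).PairwiseDisjoint fun x => eBall e x r), (s.card : ℕ∞)

/-- `(X', e')` is broader than `(X, e)`: its capacity is at least as large at every scale. -/
def Broader {X' X : Type*} (e' : X' → X' → ℝ≥0∞) (e : X → X → ℝ≥0∞) : Prop :=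
  ∀ δ : ℝ, 0 < δ → capacity e δ ≤ capacity e' δ

/-- The two-sided capacity estimate in dimension `k` for a space `(X, e)` of total volume `V`,
with constants `c` and `θ`: for `0 < r < θ`,
`V / (c r ^ k) ≤ Cap_r(X) ≤ c V / r ^ k`. -/
def CapacityEstimate {X : Type*} (e : X → X → ℝ≥0∞) (k : ℕ) (V : ℝ≥0∞) (c θ : ℝ) : Prop :=
  ∀ r : ℝ, 0 < r → r < θ →
    ENNReal.ofReal (1 / (c * r ^ k)) * V ≤ (capacity e r : ℝ≥0∞) ∧
      (capacity e r : ℝ≥0∞) ≤ ENNReal.ofReal (c / r ^ k) * V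

/-! ### Foliations -/

/-- The Euclidean space `ℝ ^ k`. -/
abbrev Euc (k : ℕ) : Type := EuclideanSpace ℝ (Fin k)

/-- A smooth foliation of dimension `p` on an `n`-dimensional smooth manifold `M`, given by a
foliated atlas: smooth charts with values in `ℝ ^ p × ℝ ^ (n - p)` that cover `M`, such that every
change of charts is locally of the form `(u, y) ↦ (a (u, y), b y)`.
(A nonempty `M` has such charts only if `p ≤ n`, so `n - p` is never truncated.) -/
structure Foliation (p n : ℕ) (M : Type*) [TopologicalSpace M] [ChartedSpace (Euc n) M] where
  /-- The foliated charts. -/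
  charts : Set (OpenPartialHomeomorph M (Euc p × Euc (n - p)))
  contMDiffOn : ∀ φ ∈ charts, ContMDiffOn (𝓡 n) 𝓘(ℝ, Euc p × Euc (n - p)) ∞ φ φ.source
  contMDiffOn_symm : ∀ φ ∈ charts,
    ContMDiffOn 𝓘(ℝ, Euc p × Euc (n - p)) (𝓡 n) ∞ φ.symm φ.target
  cover : ∀ x : M, ∃ φ ∈ charts, x ∈ φ.source
  compatible : ∀ φ ∈ charts, ∀ ψ ∈ charts, ∀ x ∈ φ.source ∩ ψ.source, ∃ U ∈ 𝓝 x,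
    ∀ z ∈ U, ∀ w ∈ U, (φ z).2 = (φ w).2 → (ψ z).2 = (ψ w).2

namespace Foliation

section Topological

variable {p n : ℕ} {M : Type*} [TopologicalSpace M] [ChartedSpace (Euc n) M]

/-- The leaf topology on `M`, generated by the open pieces `{z ∈ V | (φ z).2 = c}` of the slices
of foliated charts `φ`. -/
@[reducible] def leafTopology (F : Foliation p n M) : TopologicalSpace M :=
  TopologicalSpace.generateFrom
    {s | ∃ φ ∈ F.charts, ∃ V : Set M, IsOpen V ∧ ∃ c : Euc (n - p),
      s = {z | z ∈ φ.source ∧ z ∈ V ∧ (φ z).2 = c}}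

/-- The leaf through `x`: the connected component of `x` for the leaf topology. -/
def leaf (F : Foliation p n M) (x : M) : Set M :=
  @connectedComponent M F.leafTopology x

/-- The equivalence relation "to lie on the same leaf". -/
def leafSetoid (F : Foliation p n M) : Setoid M :=
  @connectedComponentSetoid M F.leafTopology

/-- The space of leaves `M / F`; as a quotient type of `M`, it carries the quotient of the manifold
topology of `M`. -/
abbrev LeafSpace (F : Foliation p n M) : Type _ :=
  Quotient F.leafSetoid

/-- Every leaf is compact (for the leaf topology) and the space of leaves is Hausdorff. -/
structure IsCompactHausdorff (F : Foliation p n M) : Prop where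
  isCompact_leaf : ∀ x : M, @IsCompact M F.leafTopology (F.leaf x)
  t2 : T2Space F.LeafSpace

/-- The transverse coordinate of a foliated chart. -/
def transverse (φ : OpenPartialHomeomorph M (Euc p × Euc (n - p))) (z : M) : Euc (n - p) :=
  (φ z).2

/-- The derivative at `z` of the transverse coordinate of a foliated chart. -/
def dTransverse (φ : OpenPartialHomeomorph M (Euc p × Euc (n - p))) (z : M)
    (v : TangentSpace (𝓡 n) z) : Euc (n - p) :=
  mfderiv (𝓡 n) 𝓘(ℝ, Euc (n - p)) (transverse φ) z v

/-- The tangent vectors at `z` that are tangent to the leaf through `z`. -/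
def tangent (F : Foliation p n M) (z : M) : Set (TangentSpace (𝓡 n) z) :=
  {v | ∀ φ ∈ F.charts, z ∈ φ.source → dTransverse φ z v = 0}

end Topological

section Metric

variable {p n : ℕ} {M : Type*} [TopologicalSpace M] [ChartedSpace (Euc n) M]
  [IsManifold (𝓡 n) ∞ M]

/-- The foliation is Riemannian for the metric `g`, i.e. `g` is bundle-like: near every point there
are a foliated chart and a transverse metric `h`, which depends on the transverse coordinate only,
such that for vectors `v`, `w` orthogonal to the leaves `g (v, w)` is the `h`-product of the
transverse components of `v` and `w`. -/
def IsRiemannian (F : Foliation p n M)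
    (g : ContMDiffRiemannianMetric (𝓡 n) ∞ (Euc n) (fun x : M => TangentSpace (𝓡 n) x)) : Prop :=
  ∀ x : M, ∃ φ ∈ F.charts, x ∈ φ.source ∧ ∃ U ∈ 𝓝 x,
    ∃ h : Euc (n - p) → (Euc (n - p) →L[ℝ] Euc (n - p) →L[ℝ] ℝ),
      ∀ z ∈ U, ∀ v w : TangentSpace (𝓡 n) z,
        (∀ u ∈ F.tangent z, g.inner z v u = 0) → (∀ u ∈ F.tangent z, g.inner z w u = 0) →
          g.inner z v w = h (transverse φ z) (dTransverse φ z v) (dTransverse φ z w)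

end Metric

end Foliation

/-! ### Riemannian volume -/

section Volume

variable {n : ℕ} {M : Type*} [TopologicalSpace M] [ChartedSpace (Euc n) M]
  [RiemannianBundle (fun x : M => TangentSpace (𝓡 n) x)]

/-- The volume `∫_D √(det (g (∂ᵢσ, ∂ⱼσ)))` of the piece of `M` parametrised by `σ` on `D ⊆ ℝ ^ k`,
for the induced Riemannian metric. -/
def paramVolume {k : ℕ} (σ : Euc k → M) (D : Set (Euc k)) : ℝ≥0∞ :=
  ∫⁻ u in D, ENNReal.ofReal (Real.sqrt (Matrix.det (Matrix.of fun i j : Fin k =>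
    inner ℝ (mfderiv 𝓘(ℝ, Euc k) (𝓡 n) σ u (EuclideanSpace.single i (1 : ℝ)))
      (mfderiv 𝓘(ℝ, Euc k) (𝓡 n) σ u (EuclideanSpace.single j (1 : ℝ))))))

/-- The volume of `A` computed with the family `P` of coordinate patches `(σ, D)`: the infimum, over
all countable covers of `A` by patches, of the total volume of the patches. (Where the patches are
measurable pieces of coordinate systems of a manifold, the infimum is attained by cutting the
manifold into countably many disjoint patches, and it is the Riemannian volume.) -/
def patchVolume {k : ℕ} (P : Set ((Euc k → M) × Set (Euc k))) (A : Set M) : ℝ≥0∞ :=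
  ⨅ (s : ℕ → P) (_ : A ⊆ ⋃ i, (s i).1.1 '' (s i).1.2),
    ∑' i, paramVolume (n := n) (s i).1.1 (s i).1.2

variable (n M) in
/-- The volume of the Riemannian manifold `M`, computed in its charts. -/
def manifoldVolume : ℝ≥0∞ :=
  patchVolume (n := n) {P : (Euc n → M) × Set (Euc n) | ∃ x : M,
    P.1 = (chartAt (Euc n) x).symm ∧ MeasurableSet P.2 ∧ P.2 ⊆ (chartAt (Euc n) x).target}
    Set.univ

/-- The volume of the leaf through `x` for the induced Riemannian metric, computed with the
coordinates `u ↦ φ⁻¹ (u, c)` that the foliated charts give on the leaves. -/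
def Foliation.leafVolume {p : ℕ} (F : Foliation p n M) (x : M) : ℝ≥0∞ :=
  patchVolume (n := n) {P : (Euc p → M) × Set (Euc p) | ∃ φ ∈ F.charts, ∃ c : Euc (n - p),
    P.1 = (fun u => φ.symm (u, c)) ∧ MeasurableSet P.2 ∧
      (∀ u ∈ P.2, (u, c) ∈ φ.target ∧ φ.symm (u, c) ∈ F.leaf x)}
    (F.leaf x)

/-- The distance of two points on a leaf for the induced Riemannian metric: the infimum of the
lengths of the `C¹` curves on the leaf that join them. -/
def Foliation.leafEDist {p : ℕ} (F : Foliation p n M) (x y : M) : ℝ≥0∞ :=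
  ⨅ (γ : ℝ → M) (_ : ContMDiffOn 𝓘(ℝ, ℝ) (𝓡 n) 1 γ (Set.Icc 0 1)) (_ : γ 0 = x) (_ : γ 1 = y)
    (_ : ∀ t ∈ Set.Icc (0 : ℝ) 1, γ t ∈ F.leaf x), Manifold.pathELength (𝓡 n) γ 0 1

/-- `leafEDist` on the points of the leaf through `x`. -/
def Foliation.edistOnLeaf {p : ℕ} (F : Foliation p n M) (x : M) (a b : F.leaf x) : ℝ≥0∞ :=
  F.leafEDist a b

end Volume

/-! ### The metric on the space of leaves -/

section LeafSpaceMetric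

variable {p n : ℕ} {M : Type*} [PseudoEMetricSpace M] [ChartedSpace (Euc n) M]

/-- `dist (L, L')`, the infimum of the distances between points of `L` and points of `L'`. -/
def Foliation.setDist (F : Foliation p n M) (L L' : F.LeafSpace) : ℝ≥0∞ :=
  ⨅ (x : M) (y : M) (_ : (⟦x⟧ : F.LeafSpace) = L) (_ : (⟦y⟧ : F.LeafSpace) = L'), edist x y

/-- The metric `ρ (L, L')`: the infimum of `∑ dist (Lᵢ, Lᵢ₊₁)` over all finite sequences of leaves
from `L` to `L'`. -/
def Foliation.rho (F : Foliation p n M) (L L' : F.LeafSpace) : ℝ≥0∞ :=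
  ⨅ (m : ℕ) (S : ℕ → F.LeafSpace) (_ : S 0 = L) (_ : S m = L'),
    ∑ i ∈ Finset.range m, F.setDist (S i) (S (i + 1))

end LeafSpaceMetric

/-! ### The class of foliated Riemannian manifolds -/

/-- The class `𝓜(d, C, p, n)`: `(M, F, g)` with `M` a compact `n`-dimensional Riemannian manifold
and `F` a compact Hausdorff foliation of dimension `p` satisfying the uniform bounds below. -/
structure Foliation.InClass {p n : ℕ} {M : Type*} [MetricSpace M] [ChartedSpace (Euc n) M]
    [IsManifold (𝓡 n) ∞ M] [RiemannianBundle (fun x : M => TangentSpace (𝓡 n) x)]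
    (F : Foliation p n M) (d C : ℝ) : Prop where
  isCompactHausdorff : F.IsCompactHausdorff
  /-- Balls of radius less than `d` that are disjoint in a leaf are disjoint in `M`. -/
  disjoint_balls : ∀ x : M, ∀ a b : F.leaf x, ∀ ε : ℝ, ε < d →
    Disjoint (eBall (F.edistOnLeaf x) a ε) (eBall (F.edistOnLeaf x) b ε) →
      Disjoint (eBall edist (a : M) ε) (eBall edist (b : M) ε)
  /-- The capacity estimate for the leaves, with uniform constants. -/
  leaf_capacity : ∀ x : M, ∃ c θ : ℝ, 1 ≤ c ∧ c ≤ C ∧ 1 / C ≤ θ ∧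
    CapacityEstimate (F.edistOnLeaf x) p (F.leafVolume x) c θ
  /-- The capacity estimate for `M`, with uniform constants. -/
  capacity : ∃ c θ : ℝ, 1 ≤ c ∧ c ≤ C ∧ 1 / C ≤ θ ∧
    CapacityEstimate (fun x y : M => edist x y) n (manifoldVolume n M) c θ
  leaf_volume : ∀ x : M,
    ENNReal.ofReal (1 / C) ≤ F.leafVolume x ∧ F.leafVolume x ≤ ENNReal.ofReal C
  /-- A comparable metric for which the foliation is Riemannian. -/
  exists_riemannian :
    ∃ g : ContMDiffRiemannianMetric (𝓡 n) ∞ (Euc n) (fun x : M => TangentSpace (𝓡 n) x),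
      (∀ (x : M) (v : TangentSpace (𝓡 n) x),
        1 / C * inner ℝ v v ≤ g.inner x v v ∧ g.inner x v v ≤ C * inner ℝ v v) ∧
      F.IsRiemannian g

end

universe u v

/-!
Capacities are compared at one small scale `r`.

* The pieces of maximal packings of the leaves over a maximal packing of `M'/F'` are disjoint in
  `M'`, because balls disjoint in a leaf are disjoint in `M'`. Hence `Cap_r(M')` is at least of the
  order `Cap_r(M'/F') r^(-p')`.
* For a bundle-like metric, a curve can be moved along the leaves without changing its transverse
  speed, so leaves are almost equidistant: the distance from a point of `L` to `L'` is at most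
  `2C ρ(L, L')`. Hence the leaves over a maximal packing of `M/F` come close to every point of `M`,
  and `Cap_((4C + 2)r)(M)` is at most of the order `Cap_r(M/F) r^(-p)`.

If `d_GH(M, M') ≤ r`, then `Cap_((16C + 8)r)(M') ≤ Cap_((4C + 2)r)(M)`, and the estimate of the
capacity of `M'` by its volume absorbs the change of scale. As `M'/F'` is broader than `M/F`, the
positive finite number `Cap_r(M/F)` cancels, which leaves `r^p ≤ const * r^p'`. This fails for
small `r` since `p < p'`.
-/

noncomputable section

/-! ### Capacity of metric spaces and fibrations -/

section Capacity

variable {X Y : Type*} {e : X → X → ℝ≥0∞} {eY : Y → Y → ℝ≥0∞} {r s : ℝ}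

theorem card_le_capacity {t : Finset X}
    (ht : (t : Set X).PairwiseDisjoint fun x => eBall e x r) : (t.card : ℕ∞) ≤ capacity e r :=
  le_iSup₂_of_le t ht le_rfl

theorem capacity_pos [Nonempty X] : 0 < capacity e r :=
  zero_lt_one.trans_le
    (by simpa using card_le_capacity (e := e) (r := r) (t := {Classical.arbitrary X}) (by simp))

theorem lt_capacity_iff {a : ℝ≥0∞} :
    a < capacity e r ↔
      ∃ t : Finset X, (t : Set X).PairwiseDisjoint (fun x => eBall e x r) ∧ a < t.card := by
  simp [capacity, ENat.toENNReal_iSup, lt_iSup_iff]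

theorem exists_maximal_disjoint_eBall (h : capacity e r ≠ ⊤) :
    ∃ t : Finset X, (t.card : ℕ∞) = capacity e r ∧
      ∀ x, ∃ a ∈ t, x = a ∨ ¬Disjoint (eBall e x r) (eBall e a r) := by
  classical
  obtain ⟨t, ht, hcard⟩ : ∃ t : Finset X, (t : Set X).PairwiseDisjoint (fun x => eBall e x r) ∧
      (t.card : ℕ∞) = capacity e r := by
    have hlt := h.lt_top
    simp only [capacity, iSup_subtype'] at hlt ⊢
    have : Nonempty {t : Finset X // (t : Set X).PairwiseDisjoint fun x => eBall e x r} :=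
      ⟨∅, by simp⟩
    obtain ⟨t, ht⟩ := ENat.exists_eq_iSup_of_lt_top hlt
    exact ⟨t, t.2, ht⟩
  refine ⟨t, hcard, fun x => ?_⟩
  by_contra! hx
  have hxt : x ∉ t := fun hmem => (hx x hmem).1 rfl
  have hins : ((insert x t : Finset X) : Set X).PairwiseDisjoint fun x => eBall e x r := by
    rw [Finset.coe_insert]
    exact ht.insert fun a ha _ => (hx a ha).2
  have hle := card_le_capacity hins
  rw [← hcard, Finset.card_insert_of_notMem hxt] at hle
  exact absurd hle (by exact_mod_cast Nat.not_succ_le_self t.card)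

theorem capacity_le_capacity_of_map (f : X → Y)
    (hf : ∀ x x', x ≠ x' → Disjoint (eBall e x r) (eBall e x' r) →
      f x ≠ f x' ∧ Disjoint (eBall eY (f x) s) (eBall eY (f x') s)) :
    capacity e r ≤ capacity eY s := by
  classical
  refine iSup₂_le fun t ht => ?_
  have hinj : Set.InjOn f t := fun x hx x' hx' hxx' => by_contra fun hne =>
    (hf x x' hne (ht hx hx' hne)).1 hxx'
  rw [← Finset.card_image_of_injOn hinj]
  refine card_le_capacity ?_
  rw [Finset.coe_image]
  rintro _ ⟨x, hx, rfl⟩ _ ⟨x', hx', rfl⟩ hne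
  have hxx' : x ≠ x' := fun h => hne (by rw [h])
  exact (hf x x' hxx' (ht hx hx' hxx')).2

theorem capacity_le_card_of_cover (T : Finset X)
    (hT : ∀ x, ∃ a ∈ T, e x a < ENNReal.ofReal r) : capacity e r ≤ T.card := by
  refine iSup₂_le fun t ht => ?_
  choose f hfT hf using hT
  have hcard : t.card ≤ T.card :=
    Finset.card_le_card_of_injOn f (fun x _ => hfT x) fun x hx x' hx' hxx' =>
      ht.elim_set hx hx' (f x) (hf x) (hxx' ▸ hf x')
  exact_mod_cast hcard

theorem capacity_ne_top [PseudoEMetricSpace X] [CompactSpace X] (hr : 0 < r) :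
    capacity (fun x y : X => edist x y) r ≠ ⊤ := by
  obtain ⟨T, hT⟩ := isCompact_univ.elim_nhds_subcover
    (fun x : X => Metric.eball x (ENNReal.ofReal r))
    (fun x _ => Metric.eball_mem_nhds x (ENNReal.ofReal_pos.2 hr))
  refine ne_top_of_le_ne_top (ENat.natCast_ne_top T.card) (capacity_le_card_of_cover T fun x => ?_)
  simpa using hT.2 (Set.mem_univ x)

theorem capacity_mul_le_capacity {f : X → Y} {L : Y → Set X} (hL : ∀ y, ∀ x ∈ L y, f x = y)
    {eL : ∀ y, L y → L y → ℝ≥0∞} (hf : ∀ x x', eY (f x) (f x') ≤ e x x')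
    (hdisj : ∀ y, ∀ a b : L y, Disjoint (eBall (eL y) a r) (eBall (eL y) b r) →
      Disjoint (eBall e (a : X) r) (eBall e (b : X) r))
    {a : ℝ≥0∞} (ha : ∀ y, a ≤ capacity (eL y) r) :
    capacity eY r * a ≤ (capacity e r : ℝ≥0∞) := by
  classical
  refine ENNReal.mul_le_of_forall_lt fun b hb a' ha' => ?_
  obtain ⟨s, hs, hbs⟩ := lt_capacity_iff.1 hb
  choose t ht hat using fun y => lt_capacity_iff.1 (ha'.trans_le (ha y))
  let T (y : Y) : Finset X := (t y).map (Function.Embedding.subtype _)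
  have hfT : ∀ y, ∀ x ∈ T y, f x = y := by
    intro y x hx
    obtain ⟨a, -, rfl⟩ := Finset.mem_map.1 hx
    exact hL y a a.2
  have hTdisj : (s : Set Y).PairwiseDisjoint T := fun y _ y' _ hne =>
    Finset.disjoint_left.2 fun x hx hx' => hne ((hfT y x hx).symm.trans (hfT y' x hx'))
  have hballs : (s.biUnion T : Set X).PairwiseDisjoint fun x => eBall e x r := by
    intro x hx x' hx' hne
    obtain ⟨y, hy, hxy⟩ := Finset.mem_biUnion.1 hx
    obtain ⟨y', hy', hxy'⟩ := Finset.mem_biUnion.1 hx'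
    rcases eq_or_ne y y' with rfl | hyy'
    · obtain ⟨a, ha, rfl⟩ := Finset.mem_map.1 hxy
      obtain ⟨b, hb, rfl⟩ := Finset.mem_map.1 hxy'
      exact hdisj y a b (ht y ha hb fun h => hne (by rw [h]))
    · have hYdisj : Disjoint (eBall eY (f x) r) (eBall eY (f x') r) := by
        rw [hfT y x hxy, hfT y' x' hxy']
        exact hs hy hy' hyy'
      exact (hYdisj.preimage f).mono (fun z hz => (hf x z).trans_lt hz)
        fun z hz => (hf x' z).trans_lt hz
  calc b * a' ≤ s.card * a' := by gcongr
    _ = ∑ _y ∈ s, a' := by simp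
    _ ≤ ∑ y ∈ s, ((t y).card : ℝ≥0∞) := Finset.sum_le_sum fun y _ => (hat y).le
    _ = ((s.biUnion T).card : ℝ≥0∞) := by
      rw [Finset.card_biUnion hTdisj, Nat.cast_sum]
      simp only [T, Finset.card_map]
    _ ≤ capacity e r := by exact_mod_cast card_le_capacity hballs

theorem exists_cover_of_capacity_ne_top [PseudoEMetricSpace X] {e : X → X → ℝ≥0∞}
    (he : ∀ x x', edist x x' ≤ e x x') (hr : 0 < r) (h : capacity e r ≠ ⊤) :
    ∃ t : Finset X, (t.card : ℕ∞) = capacity e r ∧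
      ∀ x, ∃ a ∈ t, edist x a < ENNReal.ofReal (2 * r) := by
  obtain ⟨t, htcard, ht⟩ := exists_maximal_disjoint_eBall h
  refine ⟨t, htcard, fun x => ?_⟩
  obtain ⟨a, hat, rfl | hxa⟩ := ht x
  · exact ⟨x, hat, by simpa using hr⟩
  · obtain ⟨z, hxz, haz⟩ := Set.not_disjoint_iff.1 hxa
    refine ⟨a, hat, ?_⟩
    calc edist x a ≤ edist x z + edist a z := edist_triangle_right _ _ _
      _ < ENNReal.ofReal r + ENNReal.ofReal r :=
        ENNReal.add_lt_add ((he x z).trans_lt hxz) ((he a z).trans_lt haz)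
      _ = ENNReal.ofReal (2 * r) := by rw [← ENNReal.ofReal_add hr.le hr.le, two_mul]

theorem exists_edist_lt_of_infEDist_le [PseudoEMetricSpace X] {f : X → Y}
    (heY : ∀ y y', eY y y' = eY y' y) {K : ℝ} (hK : 0 < K) (hr : 0 < r)
    (hf : ∀ x y, Metric.infEDist x (f ⁻¹' {y}) ≤ ENNReal.ofReal K * eY (f x) y)
    {x : X} {y : Y} (hxy : f x = y ∨ ¬Disjoint (eBall eY (f x) r) (eBall eY y r)) :
    ∃ w, f w = y ∧ edist x w < ENNReal.ofReal (2 * K * r) := by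
  have hstep : ∀ x y, eY (f x) y < ENNReal.ofReal r →
      ∃ w, f w = y ∧ edist x w < ENNReal.ofReal (K * r) := by
    intro x y h
    rw [ENNReal.ofReal_mul hK.le]
    exact Metric.infEDist_lt_iff.1 ((hf x y).trans_lt (ENNReal.mul_lt_mul_right
      (ENNReal.ofReal_pos.2 hK).ne' ENNReal.ofReal_ne_top h))
  obtain hxy | hxy := hxy
  · exact ⟨x, hxy, by simp only [edist_self, ENNReal.ofReal_pos]; positivity⟩
  · obtain ⟨z, hxz, hyz⟩ := Set.not_disjoint_iff.1 hxy
    obtain ⟨w, rfl, hxw⟩ := hstep x z hxz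
    obtain ⟨w', hw', hww'⟩ := hstep w y (by rw [heY]; exact hyz)
    refine ⟨w', hw', ?_⟩
    calc edist x w' ≤ edist x w + edist w w' := edist_triangle _ _ _
      _ < ENNReal.ofReal (K * r) + ENNReal.ofReal (K * r) := ENNReal.add_lt_add hxw hww'
      _ = ENNReal.ofReal (2 * K * r) := by
        rw [← ENNReal.ofReal_add (by positivity) (by positivity)]
        ring_nf

theorem capacity_le_capacity_mul [PseudoEMetricSpace X] {f : X → Y} {L : Y → Set X}
    (hL : ∀ x, x ∈ L (f x)) {eL : ∀ y, L y → L y → ℝ≥0∞}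
    (heL : ∀ y, ∀ a b : L y, edist (a : X) b ≤ eL y a b)
    (heY : ∀ y y', eY y y' = eY y' y) {K : ℝ} (hK : 0 < K) (hr : 0 < r)
    (hf : ∀ x y, Metric.infEDist x (f ⁻¹' {y}) ≤ ENNReal.ofReal K * eY (f x) y)
    (hY : capacity eY r ≠ ⊤) {b : ℝ≥0∞} (hb : ∀ y, capacity (eL y) r ≤ b) (hbtop : b ≠ ⊤) :
    capacity (fun x y : X => edist x y) ((2 * K + 2) * r) ≤ capacity eY r * b := by
  classical
  obtain ⟨s, hscard, hs⟩ := exists_maximal_disjoint_eBall hY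
  have hLtop (y : Y) : capacity (eL y) r ≠ ⊤ :=
    ENat.toENNReal_ne_top.1 (ne_top_of_le_ne_top hbtop (hb y))
  choose t htcard ht using fun y => exists_cover_of_capacity_ne_top (heL y) hr (hLtop y)
  let T (y : Y) : Finset X := (t y).map (Function.Embedding.subtype _)
  have hcover : ∀ x, ∃ a ∈ s.biUnion T, edist x a < ENNReal.ofReal ((2 * K + 2) * r) := by
    intro x
    obtain ⟨y, hys, hxy⟩ := hs (f x)
    obtain ⟨w, rfl, hxw⟩ := exists_edist_lt_of_infEDist_le heY hK hr hf hxy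
    obtain ⟨a, hat, hwa⟩ := ht (f w) ⟨w, hL w⟩
    refine ⟨a, Finset.mem_biUnion.2 ⟨f w, hys, Finset.mem_map.2 ⟨a, hat, rfl⟩⟩, ?_⟩
    calc edist x a ≤ edist x w + edist w a := edist_triangle _ _ _
      _ < ENNReal.ofReal (2 * K * r) + ENNReal.ofReal (2 * r) := ENNReal.add_lt_add hxw hwa
      _ = ENNReal.ofReal ((2 * K + 2) * r) := by
        rw [← ENNReal.ofReal_add (by positivity) (by positivity), add_mul]
  calc (capacity (fun x y : X => edist x y) ((2 * K + 2) * r) : ℝ≥0∞)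
      ≤ ((s.biUnion T).card : ℝ≥0∞) := by exact_mod_cast capacity_le_card_of_cover _ hcover
    _ ≤ ((∑ y ∈ s, (T y).card : ℕ) : ℝ≥0∞) := Nat.cast_le.2 Finset.card_biUnion_le
    _ = ∑ y ∈ s, (capacity (eL y) r : ℝ≥0∞) := by simp [T, ← htcard]
    _ ≤ ∑ _y ∈ s, b := Finset.sum_le_sum fun y _ => hb y
    _ = capacity eY r * b := by rw [← hscard]; simp

theorem exists_abs_dist_sub_lt_of_ghDist_lt {X Y : Type*} [MetricSpace X] [CompactSpace X]
    [Nonempty X] [MetricSpace Y] [CompactSpace Y] [Nonempty Y] {R : ℝ}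
    (h : GromovHausdorff.ghDist X Y < R) :
    ∃ f : Y → X, ∀ y y', |dist (f y) (f y') - dist y y'| < 2 * R := by
  obtain ⟨Φ, Ψ, hΦ, hΨ, hΦΨ⟩ := GromovHausdorff.ghDist_eq_hausdorffDist X Y
  have hfin : Metric.hausdorffEDist (Set.range Φ) (Set.range Ψ) ≠ ⊤ :=
    Metric.hausdorffEDist_ne_top_of_nonempty_of_bounded (Set.range_nonempty _)
      (Set.range_nonempty _) (isCompact_range hΦ.continuous).isBounded
      (isCompact_range hΨ.continuous).isBounded
  have hnear : ∀ y, ∃ x, dist (Φ x) (Ψ y) < R := by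
    intro y
    obtain ⟨_, ⟨x, rfl⟩, hx⟩ := Metric.exists_dist_lt_of_hausdorffDist_lt'
      (Set.mem_range_self y) (hΦΨ ▸ h) hfin
    exact ⟨x, hx⟩
  choose f hf using hnear
  refine ⟨f, fun y y' => ?_⟩
  have hdist := dist_dist_dist_le (Φ (f y)) (Φ (f y')) (Ψ y) (Ψ y')
  rw [hΦ.dist_eq, hΨ.dist_eq, Real.dist_eq] at hdist
  linarith [hf y, hf y']

theorem capacity_le_of_ghDist_lt {X Y : Type*} [MetricSpace X] [CompactSpace X] [Nonempty X]
    [MetricSpace Y] [CompactSpace Y] [Nonempty Y] {R : ℝ}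
    (h : GromovHausdorff.ghDist X Y < R) :
    capacity (fun x y : Y => edist x y) (4 * R) ≤ capacity (fun x y : X => edist x y) R := by
  obtain ⟨f, hf⟩ := exists_abs_dist_sub_lt_of_ghDist_lt h
  have hR : 0 < R := by
    linarith [(abs_nonneg _).trans_lt (hf (Classical.arbitrary Y) (Classical.arbitrary Y))]
  refine capacity_le_capacity_of_map f fun y y' _ hdisj => ?_
  have hyy' : 4 * R ≤ dist y y' := by
    by_contra! hlt
    refine Set.not_disjoint_iff.2 ⟨y', ?_, ?_⟩ hdisj
    · exact edist_lt_ofReal.2 hlt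
    · simp only [eBall, Set.mem_ofPred_eq, edist_self, ENNReal.ofReal_pos]
      positivity
  have hfy : 2 * R < dist (f y) (f y') := by linarith [(abs_lt.1 (hf y y')).1]
  refine ⟨fun heq => ?_, Set.disjoint_left.2 fun z hz hz' => ?_⟩
  · rw [heq, dist_self] at hfy
    linarith
  · simp only [eBall, Set.mem_ofPred_eq, edist_lt_ofReal] at hz hz'
    linarith [dist_triangle_right (f y) (f y') z]

end Capacity

section CapacityEstimate

variable {X : Type*} {e : X → X → ℝ≥0∞} {k : ℕ} {V : ℝ≥0∞} {c c' θ θ' : ℝ}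

theorem CapacityEstimate.capacity_le (h : CapacityEstimate e k V c θ) (hc : 0 < c) {r s : ℝ}
    (hr : 0 < r) (hrθ : r < θ) (hs : 0 < s) (hsθ : s < θ) :
    (capacity e r : ℝ≥0∞) ≤ ENNReal.ofReal (c ^ 2 * (s / r) ^ k) * capacity e s := by
  calc (capacity e r : ℝ≥0∞) ≤ ENNReal.ofReal (c / r ^ k) * V := (h r hr hrθ).2
    _ = ENNReal.ofReal (c ^ 2 * (s / r) ^ k) * (ENNReal.ofReal (1 / (c * s ^ k)) * V) := by
      rw [← mul_assoc, ← ENNReal.ofReal_mul (by positivity)]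
      congr 2
      rw [div_pow]
      field_simp
    _ ≤ _ := by gcongr; exact (h s hs hsθ).1

theorem CapacityEstimate.mono (h : CapacityEstimate e k V c θ) (hc : 0 < c) (hcc' : c ≤ c')
    (hθ : θ' ≤ θ) : CapacityEstimate e k V c' θ' := by
  intro r hr hrθ
  obtain ⟨hlower, hupper⟩ := h r hr (hrθ.trans_le hθ)
  refine ⟨le_trans ?_ hlower, hupper.trans ?_⟩ <;> gcongr

theorem CapacityEstimate.of_volume {A : ℝ} (h : CapacityEstimate e k V c θ) (hc : 0 < c)
    (hVlower : ENNReal.ofReal (1 / A) ≤ V) (hVupper : V ≤ ENNReal.ofReal A) :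
    CapacityEstimate e k 1 (c * A) θ := by
  intro r hr hrθ
  obtain ⟨hlower, hupper⟩ := h r hr hrθ
  rw [mul_one, mul_one]
  constructor
  · calc ENNReal.ofReal (1 / (c * A * r ^ k))
        = ENNReal.ofReal (1 / (c * r ^ k)) * ENNReal.ofReal (1 / A) := by
          rw [← ENNReal.ofReal_mul (by positivity), one_div_mul_one_div]
          ring_nf
      _ ≤ ENNReal.ofReal (1 / (c * r ^ k)) * V := by gcongr
      _ ≤ _ := hlower
  · calc (capacity e r : ℝ≥0∞) ≤ ENNReal.ofReal (c / r ^ k) * V := hupper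
      _ ≤ ENNReal.ofReal (c / r ^ k) * ENNReal.ofReal A := by gcongr
      _ = ENNReal.ofReal (c * A / r ^ k) := by
          rw [← ENNReal.ofReal_mul (by positivity), div_mul_eq_mul_div]

end CapacityEstimate

/-! ### Leaves and their tangent spaces -/

namespace Foliation

section LeafTopology

variable {p n : ℕ} {M : Type*} [TopologicalSpace M] [ChartedSpace (Euc n) M]
  {φ ψ : OpenPartialHomeomorph M (Euc p × Euc (n - p))} (F : Foliation p n M)

theorem mem_leaf_self (x : M) : x ∈ F.leaf x :=
  @mem_connectedComponent M F.leafTopology x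

theorem leaf_eq_of_mem {x y : M} (h : y ∈ F.leaf x) : F.leaf x = F.leaf y :=
  @connectedComponent_eq M F.leafTopology x y h

theorem mk_eq_mk_iff_mem_leaf {x y : M} : (⟦x⟧ : F.LeafSpace) = ⟦y⟧ ↔ y ∈ F.leaf x :=
  Quotient.eq.trans ⟨fun h : F.leaf x = F.leaf y => h ▸ F.mem_leaf_self y, F.leaf_eq_of_mem⟩

theorem isOpen_plaque (hφ : φ ∈ F.charts) {V : Set M} (hV : IsOpen V) (c : Euc (n - p)) :
    IsOpen[F.leafTopology] {z | z ∈ φ.source ∧ z ∈ V ∧ (φ z).2 = c} :=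
  TopologicalSpace.isOpen_generateFrom_of_mem ⟨φ, hφ, V, hV, c, rfl⟩

theorem eventually_transverse_symm_eq (hφ : φ ∈ F.charts) (hψ : ψ ∈ F.charts)
    {y : Euc p × Euc (n - p)} (hy : y ∈ φ.target) (hyψ : φ.symm y ∈ ψ.source) :
    ∀ᶠ y' in 𝓝 y, y'.2 = y.2 → transverse ψ (φ.symm y') = transverse ψ (φ.symm y) := by
  obtain ⟨U, hU, hcompat⟩ := F.compatible φ hφ ψ hψ (φ.symm y) ⟨φ.map_target hy, hyψ⟩
  filter_upwards [φ.open_target.mem_nhds hy, (φ.continuousAt_symm hy).eventually hU]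
    with y' hy' hy'U h
  refine hcompat _ hy'U _ (mem_of_mem_nhds hU) ?_
  rw [φ.right_inv hy', φ.right_inv hy, h]

theorem continuousOn_slice (hφ : φ ∈ F.charts) (c : Euc (n - p)) {s : Set (Euc p)}
    (hs : ∀ u ∈ s, (u, c) ∈ φ.target) :
    @ContinuousOn _ _ _ F.leafTopology (fun u : Euc p => φ.symm (u, c)) s := by
  refine (@continuousOn_iff_continuous_domRestrict _ _ _ F.leafTopology _ _).2 ?_
  refine continuous_generateFrom_iff.2 ?_
  rintro _ ⟨ψ, hψ, V, hV, c', rfl⟩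
  rw [isOpen_iff_mem_nhds]
  rintro ⟨u, hu⟩ ⟨huψ, huV, huc⟩
  have hpair : ContinuousAt (fun w : s => ((w : Euc p), c)) ⟨u, hu⟩ := by fun_prop
  have hslice : ContinuousAt (fun w : s => φ.symm ((w : Euc p), c)) ⟨u, hu⟩ :=
    ContinuousAt.comp_of_eq (φ.continuousAt_symm (hs u hu)) hpair rfl
  filter_upwards [hslice.eventually (ψ.open_source.mem_nhds huψ),
    hslice.eventually (hV.mem_nhds huV),
    hpair.eventually (F.eventually_transverse_symm_eq hφ hψ (hs u hu) huψ)] with w hwψ hwV hwc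
  exact ⟨hwψ, hwV, (hwc rfl).trans huc⟩

theorem mem_leaf_of_transverse_eq (hφ : φ ∈ F.charts) {y : Euc p × Euc (n - p)} {η : ℝ}
    (hη : Metric.ball y η ⊆ φ.target) {z w : M} (hz : z ∈ φ.source) (hw : w ∈ φ.source)
    (hzy : φ z ∈ Metric.ball y η) (hwy : φ w ∈ Metric.ball y η)
    (h : transverse φ z = transverse φ w) : w ∈ F.leaf z := by
  rw [← ball_prod_same] at hη hzy hwy
  have hslice := F.continuousOn_slice hφ (φ z).2 (s := Metric.ball y.1 η)
    (fun u hu => hη ⟨hu, hzy.2⟩)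
  refine @IsPreconnected.subset_connectedComponent _ F.leafTopology _ _
    (@IsPreconnected.image _ _ _ F.leafTopology _ (convex_ball y.1 η).isPreconnected _ hslice)
    ?_ _ ?_
  · exact ⟨(φ z).1, hzy.1, φ.left_inv hz⟩
  · refine ⟨(φ w).1, hwy.1, ?_⟩
    change φ.symm ((φ w).1, transverse φ z) = w
    rw [h]
    exact φ.left_inv hw

theorem leaf_subset_of_plaque_invariant {S : Set M}
    (hS : ∀ x : M, ∃ φ ∈ F.charts, ∃ V : Set M, IsOpen V ∧ x ∈ V ∧ V ⊆ φ.source ∧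
      ∀ z ∈ V, ∀ w ∈ V, transverse φ z = transverse φ w → z ∈ S → w ∈ S) {x : M} (hx : x ∈ S) :
    F.leaf x ⊆ S := by
  have hlocal : ∀ x : M, ∃ N, IsOpen[F.leafTopology] N ∧ x ∈ N ∧
      ∀ z ∈ N, ∀ w ∈ N, z ∈ S → w ∈ S := by
    intro x
    obtain ⟨φ, hφ, V, hV, hxV, hVs, h⟩ := hS x
    refine ⟨_, F.isOpen_plaque hφ hV (φ x).2, ⟨hVs hxV, hxV, rfl⟩, ?_⟩
    rintro z ⟨_, hz, hzx⟩ w ⟨_, hw, hwx⟩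
    exact h z hz w hw (hzx.trans hwx.symm)
  have hclopen : @IsClopen M F.leafTopology S := by
    refine ⟨(@isOpen_compl_iff M S F.leafTopology).1
      ((@isOpen_iff_forall_mem_open _ F.leafTopology _).2 fun z hz => ?_),
      (@isOpen_iff_forall_mem_open _ F.leafTopology _).2 fun z hz => ?_⟩ <;>
    obtain ⟨N, hN, hzN, h⟩ := hlocal z
    · exact ⟨N, fun w hw hwS => hz (h w hw z hzN hwS), hN, hzN⟩
    · exact ⟨N, fun w hw => h z hzN w hw hz, hN, hzN⟩
  exact @IsClopen.connectedComponent_subset _ F.leafTopology _ _ hclopen hx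

end LeafTopology

section Tangent

variable {p n : ℕ} {M : Type*} [TopologicalSpace M] [ChartedSpace (Euc n) M]
  {φ ψ : OpenPartialHomeomorph M (Euc p × Euc (n - p))} {F : Foliation p n M}

theorem mdifferentiable_of_mem_charts (hφ : φ ∈ F.charts) :
    φ.MDifferentiable (𝓡 n) 𝓘(ℝ, Euc p × Euc (n - p)) :=
  ⟨(F.contMDiffOn φ hφ).mdifferentiableOn (by simp),
    (F.contMDiffOn_symm φ hφ).mdifferentiableOn (by simp)⟩

theorem mdifferentiableAt_transverse (hφ : φ ∈ F.charts) {z : M} (hz : z ∈ φ.source) :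
    MDifferentiableAt (𝓡 n) 𝓘(ℝ, Euc (n - p)) (transverse φ) z :=
  (ContinuousLinearMap.snd ℝ (Euc p) (Euc (n - p))).mdifferentiableAt.comp z
    ((mdifferentiable_of_mem_charts hφ).mdifferentiableAt hz)

theorem dTransverse_eq_snd_mfderiv (hφ : φ ∈ F.charts) {z : M} (hz : z ∈ φ.source)
    (v : TangentSpace (𝓡 n) z) :
    dTransverse φ z v =
      Prod.snd (mfderiv (𝓡 n) 𝓘(ℝ, Euc p × Euc (n - p)) φ z v : Euc p × Euc (n - p)) := by
  have h := ((ContinuousLinearMap.snd ℝ (Euc p) (Euc (n - p))).hasMFDerivAt (x := φ z)).comp z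
    ((mdifferentiable_of_mem_charts hφ).mdifferentiableAt hz).hasMFDerivAt
  exact DFunLike.congr_fun h.mfderiv v

theorem dTransverse_mfderiv_symm (hφ : φ ∈ F.charts) {y : Euc p × Euc (n - p)}
    (hy : y ∈ φ.target) (e : Euc p × Euc (n - p)) :
    dTransverse φ (φ.symm y) (mfderiv 𝓘(ℝ, Euc p × Euc (n - p)) (𝓡 n) φ.symm y e) = e.2 := by
  rw [dTransverse_eq_snd_mfderiv hφ (φ.map_target hy)]
  exact congrArg Prod.snd
    (DFunLike.congr_fun ((mdifferentiable_of_mem_charts hφ).comp_symm_deriv hy) e)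

theorem dTransverse_mfderiv_symm_of_snd_eq_zero (hφ : φ ∈ F.charts) (hψ : ψ ∈ F.charts)
    {y : Euc p × Euc (n - p)} (hy : y ∈ φ.target) (hyψ : φ.symm y ∈ ψ.source)
    {e : Euc p × Euc (n - p)} (he : e.2 = 0) :
    dTransverse ψ (φ.symm y) (mfderiv 𝓘(ℝ, Euc p × Euc (n - p)) (𝓡 n) φ.symm y e) = 0 := by
  have hcomp : HasFDerivAt (transverse ψ ∘ φ.symm) _ y := hasMFDerivAt_iff_hasFDerivAt.1 <|
    (mdifferentiableAt_transverse hψ hyψ).hasMFDerivAt.comp y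
      ((mdifferentiable_of_mem_charts hφ).mdifferentiableAt_symm hy).hasMFDerivAt
  have hline : HasDerivAt (fun t : ℝ => y + t • e) e 0 := by
    simpa using ((hasDerivAt_id (0 : ℝ)).smul_const e).const_add y
  have hderiv := HasFDerivAt.comp_hasDerivAt_of_eq (0 : ℝ) hcomp hline (by simp)
  have hconst : (transverse ψ ∘ φ.symm) ∘ (fun t : ℝ => y + t • e) =ᶠ[𝓝 0]
      fun _ => transverse ψ (φ.symm y) := by
    have htendsto : Filter.Tendsto (fun t : ℝ => y + t • e) (𝓝 0) (𝓝 y) := by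
      simpa [ContinuousAt] using hline.continuousAt
    filter_upwards [htendsto.eventually (F.eventually_transverse_symm_eq hφ hψ hy hyψ)] with t ht
    exact ht (by simp [he])
  exact (hderiv.congr_of_eventuallyEq hconst.symm).unique (hasDerivAt_const _ _)

theorem mem_tangent_iff (hφ : φ ∈ F.charts) {z : M} (hz : z ∈ φ.source)
    {v : TangentSpace (𝓡 n) z} : v ∈ F.tangent z ↔ dTransverse φ z v = 0 := by
  refine ⟨fun h => h φ hφ hz, fun h ψ hψ hzψ => ?_⟩
  obtain ⟨y, hy, rfl⟩ : ∃ y ∈ φ.target, φ.symm y = z := ⟨φ z, φ.map_source hz, φ.left_inv hz⟩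
  obtain ⟨e, rfl⟩ := (mdifferentiable_of_mem_charts hφ).symm.mfderiv_surjective hy v
  exact dTransverse_mfderiv_symm_of_snd_eq_zero hφ hψ hy hzψ
    ((dTransverse_mfderiv_symm hφ hy e).symm.trans h)

variable (F) in
/-- `F.tangent z`, the tangent space of the leaf through `z`, as a subspace. -/
def tangentSubmodule (z : M) : Submodule ℝ (TangentSpace (𝓡 n) z) :=
  ⨅ (φ ∈ F.charts) (_ : z ∈ φ.source),
    LinearMap.ker (mfderiv (𝓡 n) 𝓘(ℝ, Euc (n - p)) (transverse φ) z).toLinearMap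

theorem mem_tangentSubmodule {z : M} {v : TangentSpace (𝓡 n) z} :
    v ∈ F.tangentSubmodule z ↔ v ∈ F.tangent z := by
  simp only [tangentSubmodule, Submodule.mem_iInf]
  rfl

theorem sub_mem_tangent_iff (hφ : φ ∈ F.charts) {z : M} (hz : z ∈ φ.source)
    {v w : TangentSpace (𝓡 n) z} :
    v - w ∈ F.tangent z ↔ dTransverse φ z v = dTransverse φ z w := by
  have hsub : dTransverse φ z (v - w) = dTransverse φ z v - dTransverse φ z w :=
    map_sub (mfderiv (𝓡 n) 𝓘(ℝ, Euc (n - p)) (transverse φ) z) v w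
  rw [mem_tangent_iff hφ hz, hsub, sub_eq_zero]

end Tangent

end Foliation

/-! ### The length transverse to the leaves -/

theorem isCompl_orthogonal_of_pos {V : Type*} [AddCommGroup V] [Module ℝ V]
    [FiniteDimensional ℝ V] {B : LinearMap.BilinForm ℝ V} (hsymm : B.IsSymm)
    (hpos : ∀ v, v ≠ 0 → 0 < B v v) (W : Submodule ℝ V) : IsCompl W (B.orthogonal W) := by
  rw [LinearMap.BilinForm.isCompl_orthogonal_iff_disjoint hsymm.isRefl, Submodule.disjoint_def]
  intro v hv hv'
  by_contra hne
  exact (hpos v hne).ne' (hv' v hv)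

namespace Foliation

section Normal

variable {p n : ℕ} {M : Type*} [TopologicalSpace M] [ChartedSpace (Euc n) M]
  [IsManifold (𝓡 n) ∞ M] {φ : OpenPartialHomeomorph M (Euc p × Euc (n - p))}
  (F : Foliation p n M)
  (g : ContMDiffRiemannianMetric (𝓡 n) ∞ (Euc n) (fun x : M => TangentSpace (𝓡 n) x))

theorem isCompl_tangent_orthogonal (z : M) :
    IsCompl (F.tangentSubmodule z) ((g.inner z).toBilinForm.orthogonal (F.tangentSubmodule z)) :=
  have : FiniteDimensional ℝ (TangentSpace (𝓡 n) z) :=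
    inferInstanceAs (FiniteDimensional ℝ (Euc n))
  isCompl_orthogonal_of_pos ⟨g.symm z⟩ (g.pos z) _

/-- The `g`-orthogonal projection of tangent vectors to the normal space of the leaves. -/
def normalProj (z : M) : TangentSpace (𝓡 n) z →ₗ[ℝ] TangentSpace (𝓡 n) z :=
  Submodule.projection _ _ (F.isCompl_tangent_orthogonal g z).symm

/-- The squared `g`-length of the component of `v` normal to the leaves. -/
def normalSq (z : M) (v : TangentSpace (𝓡 n) z) : ℝ :=
  g.inner z (F.normalProj g z v) (F.normalProj g z v)

variable {F g}

theorem inner_normalProj_eq_zero {z : M} (v : TangentSpace (𝓡 n) z) {u : TangentSpace (𝓡 n) z}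
    (hu : u ∈ F.tangent z) : g.inner z (F.normalProj g z v) u = 0 := by
  rw [g.symm]
  exact Submodule.projection_apply_mem (F.isCompl_tangent_orthogonal g z).symm v u
    (mem_tangentSubmodule.2 hu)

theorem sub_normalProj_mem_tangent {z : M} (v : TangentSpace (𝓡 n) z) :
    v - F.normalProj g z v ∈ F.tangent z :=
  mem_tangentSubmodule.1 (Submodule.sub_projection_mem (F.isCompl_tangent_orthogonal g z).symm v)

theorem normalProj_congr {z : M} {v w : TangentSpace (𝓡 n) z} (h : v - w ∈ F.tangent z) :
    F.normalProj g z v = F.normalProj g z w := by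
  rw [← sub_eq_zero, ← map_sub]
  exact (Submodule.projection_apply_eq_zero_iff _).2 (mem_tangentSubmodule.2 h)

theorem normalSq_le (z : M) (v : TangentSpace (𝓡 n) z) : F.normalSq g z v ≤ g.inner z v v := by
  set w := F.normalProj g z v with hw
  set u := v - w
  have hortho : g.inner z w u = 0 := inner_normalProj_eq_zero v (sub_normalProj_mem_tangent v)
  have hnonneg : 0 ≤ g.inner z u u := by
    by_cases hu : u = 0
    · simp [hu]
    · exact (g.pos z u hu).le
  have hv : v = w + u := (add_sub_cancel w v).symm
  have hpyth : g.inner z v v = g.inner z w w + g.inner z u u := by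
    rw [hv]
    simp only [map_add, add_apply]
    rw [g.symm z u w, hortho]
    ring
  rw [normalSq, ← hw, hpyth]
  linarith

theorem dTransverse_normalProj (hφ : φ ∈ F.charts) {z : M} (hz : z ∈ φ.source)
    (v : TangentSpace (𝓡 n) z) : dTransverse φ z (F.normalProj g z v) = dTransverse φ z v :=
  ((sub_mem_tangent_iff hφ hz).1 (sub_normalProj_mem_tangent v)).symm

theorem normalSq_congr (hφ : φ ∈ F.charts) {z : M} (hz : z ∈ φ.source)
    {v w : TangentSpace (𝓡 n) z} (h : dTransverse φ z v = dTransverse φ z w) :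
    F.normalSq g z v = F.normalSq g z w := by
  simp only [normalSq, normalProj_congr ((sub_mem_tangent_iff hφ hz).2 h)]

theorem IsRiemannian.exists_normalSq_eq (hg : F.IsRiemannian g) (x : M) :
    ∃ φ ∈ F.charts, x ∈ φ.source ∧ ∃ U ∈ 𝓝 x, ∀ z ∈ U ∩ φ.source, ∀ z' ∈ U ∩ φ.source,
      transverse φ z = transverse φ z' → ∀ v v', dTransverse φ z v = dTransverse φ z' v' →
        F.normalSq g z v = F.normalSq g z' v' := by
  obtain ⟨φ, hφ, hx, U, hU, h, hh⟩ := hg x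
  refine ⟨φ, hφ, hx, U, hU, ?_⟩
  have hval : ∀ z ∈ U ∩ φ.source, ∀ v, F.normalSq g z v =
      h (transverse φ z) (dTransverse φ z v) (dTransverse φ z v) := by
    intro z hz v
    rw [normalSq, hh z hz.1 _ _ (fun _ => inner_normalProj_eq_zero v)
      (fun _ => inner_normalProj_eq_zero v), dTransverse_normalProj hφ hz.2]
  intro z hz z' hz' hzz' v v' hvv'
  rw [hval z hz, hval z' hz', hzz', hvv']

end Normal

end Foliation

/-! ### Riemannian metrics in charts -/

section ChartNorm

variable {n : ℕ} {M : Type*} [TopologicalSpace M] [ChartedSpace (Euc n) M]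
  [IsManifold (𝓡 n) ∞ M] {E : Type*} [NormedAddCommGroup E] [NormedSpace ℝ E]
  (g : ContMDiffRiemannianMetric (𝓡 n) ∞ (Euc n) (fun x : M => TangentSpace (𝓡 n) x))
  (φ : OpenPartialHomeomorph M E)

/-- The quadratic form of the metric `g` in the coordinates of the chart `φ`, at the point with
coordinates `y`. -/
def chartNormSq (y e : E) : ℝ :=
  g.inner (φ.symm y) (mfderiv 𝓘(ℝ, E) (𝓡 n) φ.symm y e) (mfderiv 𝓘(ℝ, E) (𝓡 n) φ.symm y e)

theorem chartNormSq_smul (c : ℝ) (y e : E) :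
    chartNormSq g φ y (c • e) = c ^ 2 * chartNormSq g φ y e := by
  have hsmul : mfderiv 𝓘(ℝ, E) (𝓡 n) φ.symm y (c • e) = c • mfderiv 𝓘(ℝ, E) (𝓡 n) φ.symm y e :=
    map_smul (mfderiv 𝓘(ℝ, E) (𝓡 n) φ.symm y) c e
  rw [chartNormSq, hsmul]
  simp only [map_smul, smul_apply, smul_eq_mul, chartNormSq]
  ring

variable {φ}

theorem chartNormSq_pos (hφ : φ.MDifferentiable (𝓡 n) 𝓘(ℝ, E)) {y e : E} (hy : y ∈ φ.target)
    (he : e ≠ 0) : 0 < chartNormSq g φ y e :=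
  g.pos _ _ fun h => he (hφ.symm.mfderiv_injective hy (h.trans (map_zero _).symm))

theorem continuousOn_chartNormSq (hφ : ContMDiffOn 𝓘(ℝ, E) (𝓡 n) ∞ φ.symm φ.target) :
    ContinuousOn (fun q : E × E => chartNormSq g φ q.1 q.2) (φ.target ×ˢ Set.univ) := by
  have htangentMap : ContinuousOn (fun q : E × E =>
      TotalSpace.mk' (Euc n) (E := fun x : M => TangentSpace (𝓡 n) x) (φ.symm q.1)
        (mfderiv 𝓘(ℝ, E) (𝓡 n) φ.symm q.1 q.2)) (φ.target ×ˢ Set.univ) := by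
    refine ((hφ.continuousOn_tangentMapWithin (by simp) φ.open_target.uniqueMDiffOn).comp
      (t := π _ (TangentSpace 𝓘(ℝ, E)) ⁻¹' φ.target)
      (tangentBundleModelSpaceHomeomorph 𝓘(ℝ, E)).symm.continuous.continuousOn
      (fun q hq => hq.1)).congr fun q hq => ?_
    exact congrArg (fun L : E →L[ℝ] TangentSpace (𝓡 n) (φ.symm q.1) =>
      TotalSpace.mk' (Euc n) (E := fun x : M => TangentSpace (𝓡 n) x) (φ.symm q.1) (L q.2))
      (mfderivWithin_of_isOpen φ.open_target hq.1).symm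
  have hbase : ContinuousOn (fun q : E × E => φ.symm q.1) (φ.target ×ˢ Set.univ) :=
    φ.continuousOn_symm.comp continuous_fst.continuousOn fun q hq => hq.1
  have hbundle := (g.contMDiff.continuous.comp_continuousOn hbase).clm_bundle_apply₂
    (F₁ := Euc n) (F₂ := Euc n) (F₃ := ℝ) (E₃ := Bundle.Trivial M ℝ) htangentMap htangentMap
  intro q hq
  have hq' := hbundle q hq
  rw [FiberBundle.continuousWithinAt_totalSpace] at hq'
  exact hq'.2

theorem eventually_chartNormSq_le [FiniteDimensional ℝ E] (hd : φ.MDifferentiable (𝓡 n) 𝓘(ℝ, E))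
    (hφ : ContMDiffOn 𝓘(ℝ, E) (𝓡 n) ∞ φ.symm φ.target) {y₀ : E} (hy₀ : y₀ ∈ φ.target) :
    ∀ᶠ y in 𝓝 y₀, ∀ e, chartNormSq g φ y e ≤ 2 * chartNormSq g φ y₀ e ∧
      chartNormSq g φ y₀ e ≤ 2 * chartNormSq g φ y e := by
  have hsphere : ∀ᶠ y in 𝓝 y₀, ∀ e ∈ Metric.sphere (0 : E) 1,
      chartNormSq g φ y e ≤ 2 * chartNormSq g φ y₀ e ∧
        chartNormSq g φ y₀ e ≤ 2 * chartNormSq g φ y e := by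
    refine (isCompact_sphere _ _).eventually_forall_of_forall_eventually fun e he => ?_
    have hpos := chartNormSq_pos g hd hy₀ (ne_zero_of_mem_unit_sphere ⟨e, he⟩)
    have hc : ContinuousAt (fun q : E × E => chartNormSq g φ q.1 q.2) (y₀, e) :=
      (continuousOn_chartNormSq g hφ).continuousAt
        ((φ.open_target.prod isOpen_univ).mem_nhds ⟨hy₀, trivial⟩)
    have hc₀ : ContinuousAt (fun q : E × E => chartNormSq g φ y₀ q.2) (y₀, e) :=
      ContinuousAt.comp_of_eq (f := fun q : E × E => (y₀, q.2)) hc (by fun_prop) rfl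
    filter_upwards [hc.eventually_lt (hc₀.const_mul 2) (by linarith),
      hc₀.eventually_lt (hc.const_mul 2) (by linarith)] with q h h₀
    exact ⟨h.le, h₀.le⟩
  filter_upwards [hsphere] with y hy e
  obtain rfl | he := eq_or_ne e 0
  · have hzero : ∀ y : E, chartNormSq g φ y 0 = 0 := fun y => by
      simpa using chartNormSq_smul g φ 0 y 0
    simp only [hzero, mul_zero, le_refl, and_self]
  have hscale := hy (‖e‖⁻¹ • e) (by simp [norm_smul, he])
  have hinv : 0 < ‖e‖⁻¹ ^ 2 := by positivity
  simp only [chartNormSq_smul, mul_left_comm (2 : ℝ)] at hscale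
  exact ⟨le_of_mul_le_mul_left hscale.1 hinv, le_of_mul_le_mul_left hscale.2 hinv⟩

end ChartNorm

namespace Foliation

section AdaptedBox

variable {p n : ℕ} {M : Type*} [TopologicalSpace M] [ChartedSpace (Euc n) M]
  [IsManifold (𝓡 n) ∞ M] {F : Foliation p n M}
  {g : ContMDiffRiemannianMetric (𝓡 n) ∞ (Euc n) (fun x : M => TangentSpace (𝓡 n) x)}

/-- A ball in the coordinates of a foliated chart `φ` in which the transverse length depends only
on the transverse coordinates, together with a linear section `A` of the projection to the
transverse coordinates whose values are almost normal to the leaves: their squared length is at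
most `4` times the squared length of their normal component. -/
structure IsAdaptedBox (F : Foliation p n M)
    (g : ContMDiffRiemannianMetric (𝓡 n) ∞ (Euc n) (fun x : M => TangentSpace (𝓡 n) x))
    (φ : OpenPartialHomeomorph M (Euc p × Euc (n - p))) (y₀ : Euc p × Euc (n - p)) (η : ℝ)
    (A : Euc (n - p) →L[ℝ] Euc p × Euc (n - p)) : Prop where
  mem_charts : φ ∈ F.charts
  ball_subset : Metric.ball y₀ η ⊆ φ.target
  snd_apply : ∀ b, (A b).2 = b
  normalSq_eq : ∀ z ∈ φ.source, φ z ∈ Metric.ball y₀ η → ∀ z' ∈ φ.source, φ z' ∈ Metric.ball y₀ η →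
    transverse φ z = transverse φ z' → ∀ v v', dTransverse φ z v = dTransverse φ z' v' →
      F.normalSq g z v = F.normalSq g z' v'
  chartNormSq_le : ∀ y ∈ Metric.ball y₀ η, ∀ b, chartNormSq g φ y (A b) ≤
    4 * F.normalSq g (φ.symm y) (mfderiv 𝓘(ℝ, Euc p × Euc (n - p)) (𝓡 n) φ.symm y (A b))

variable (F g) in
/-- The vector with transverse component `b` that represents, in the coordinates `y` of `φ`, a
vector `g`-normal to the leaves. -/
def normalLift (φ : OpenPartialHomeomorph M (Euc p × Euc (n - p))) (y : Euc p × Euc (n - p)) :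
    Euc (n - p) →ₗ[ℝ] Euc p × Euc (n - p) :=
  (mfderiv (𝓡 n) 𝓘(ℝ, Euc p × Euc (n - p)) φ (φ.symm y)).toLinearMap ∘ₗ
    F.normalProj g (φ.symm y) ∘ₗ
      (mfderiv 𝓘(ℝ, Euc p × Euc (n - p)) (𝓡 n) φ.symm y).toLinearMap ∘ₗ
        LinearMap.inr ℝ (Euc p) (Euc (n - p))

variable {φ : OpenPartialHomeomorph M (Euc p × Euc (n - p))} {y : Euc p × Euc (n - p)}

theorem snd_normalLift (hφ : φ ∈ F.charts) (hy : y ∈ φ.target) (b : Euc (n - p)) :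
    (F.normalLift g φ y b).2 = b :=
  (dTransverse_eq_snd_mfderiv hφ (φ.map_target hy) _).symm.trans <|
    (dTransverse_normalProj hφ (φ.map_target hy) _).trans (dTransverse_mfderiv_symm hφ hy (0, b))

theorem chartNormSq_normalLift (hφ : φ ∈ F.charts) (hy : y ∈ φ.target)
    (e : Euc p × Euc (n - p)) :
    chartNormSq g φ y (F.normalLift g φ y e.2) =
      F.normalSq g (φ.symm y) (mfderiv 𝓘(ℝ, Euc p × Euc (n - p)) (𝓡 n) φ.symm y e) := by
  set w := mfderiv 𝓘(ℝ, Euc p × Euc (n - p)) (𝓡 n) φ.symm y (0, e.2)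
  have hlift : mfderiv 𝓘(ℝ, Euc p × Euc (n - p)) (𝓡 n) φ.symm y (F.normalLift g φ y e.2) =
      F.normalProj g (φ.symm y) w := by
    have hd := mdifferentiable_of_mem_charts hφ
    obtain ⟨u, hu⟩ := hd.symm.mfderiv_surjective hy (F.normalProj g (φ.symm y) w)
    have hinv := DFunLike.congr_fun (hd.comp_symm_deriv hy) u
    exact (congrArg (mfderiv 𝓘(ℝ, Euc p × Euc (n - p)) (𝓡 n) φ.symm y)
      ((congrArg (mfderiv (𝓡 n) 𝓘(ℝ, Euc p × Euc (n - p)) φ (φ.symm y)) hu).symm.trans hinv)).trans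
        hu
  have hw : dTransverse φ (φ.symm y) w =
      dTransverse φ (φ.symm y) (mfderiv 𝓘(ℝ, Euc p × Euc (n - p)) (𝓡 n) φ.symm y e) :=
    (dTransverse_mfderiv_symm hφ hy (0, e.2)).trans (dTransverse_mfderiv_symm hφ hy e).symm
  rw [← normalSq_congr hφ (φ.map_target hy) hw, chartNormSq, hlift, normalSq]

theorem exists_isAdaptedBox (hg : F.IsRiemannian g) (z₀ : M) :
    ∃ φ, z₀ ∈ φ.source ∧ ∃ η > 0, ∃ A, F.IsAdaptedBox g φ (φ z₀) η A := by
  obtain ⟨φ, hφ, hz₀, U, hU, hUeq⟩ := hg.exists_normalSq_eq z₀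
  have hy₀ := φ.map_source hz₀
  have hcomparable := eventually_chartNormSq_le g (mdifferentiable_of_mem_charts hφ)
    (F.contMDiffOn_symm φ hφ) hy₀
  have hU' : ∀ᶠ y in 𝓝 (φ z₀), φ.symm y ∈ U :=
    (φ.continuousAt_symm hy₀).eventually (by rwa [φ.left_inv hz₀])
  obtain ⟨η, hη, hball⟩ := Metric.eventually_nhds_iff_ball.1
    (hcomparable.and (hU'.and (φ.open_target.mem_nhds hy₀)))
  have hmemU : ∀ z ∈ φ.source, φ z ∈ Metric.ball (φ z₀) η → z ∈ U ∩ φ.source := fun z hz hzη =>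
    ⟨by simpa only [φ.left_inv hz] using (hball _ hzη).2.1, hz⟩
  refine ⟨φ, hz₀, η, hη, (F.normalLift g φ (φ z₀)).toContinuousLinearMap, hφ,
    fun y hy => (hball y hy).2.2, snd_normalLift hφ hy₀, fun z hz hzη z' hz' hzη' =>
    hUeq z (hmemU z hz hzη) z' (hmemU z' hz' hzη'), fun y hy b => ?_⟩
  obtain ⟨hcomp, -, hyt⟩ := hball y hy
  have hminimal : chartNormSq g φ (φ z₀) (F.normalLift g φ (φ z₀) b) ≤
      chartNormSq g φ (φ z₀) (F.normalLift g φ y b) := by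
    have h := normalSq_le (F := F) (g := g) _ (mfderiv 𝓘(ℝ, Euc p × Euc (n - p)) (𝓡 n) φ.symm (φ z₀)
      (F.normalLift g φ y b))
    rwa [← chartNormSq_normalLift hφ hy₀, snd_normalLift hφ hyt] at h
  have hnormal := chartNormSq_normalLift (g := g) hφ hyt (F.normalLift g φ (φ z₀) b)
  rw [snd_normalLift hφ hy₀] at hnormal
  have := (hcomp (F.normalLift g φ (φ z₀) b)).1
  have := (hcomp (F.normalLift g φ y b)).2
  rw [LinearMap.coe_toContinuousLinearMap', ← hnormal]
  linarith

end AdaptedBox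

end Foliation

/-! ### Transport of curves along the leaves -/

theorem dist_add_apply_sub_lt {E E' : Type*} [NormedAddCommGroup E] [NormedSpace ℝ E]
    [NormedAddCommGroup E'] [NormedSpace ℝ E'] (A : E' →L[ℝ] E × E') {y₀ y₁ y z : E × E'} {δ : ℝ}
    (hy₁ : dist y₁ y₀ < δ) (hy : dist y y₀ < δ) (hz : dist z y₀ < δ) :
    dist (y₁ + A (y.2 - z.2)) y₀ < (2 * ‖A‖ + 1) * δ := by
  have hsub : ‖y.2 - z.2‖ ≤ 2 * δ := by
    calc ‖y.2 - z.2‖ ≤ ‖y - z‖ := norm_snd_le (y - z)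
      _ = dist y z := (dist_eq_norm y z).symm
      _ ≤ dist y y₀ + dist z y₀ := dist_triangle_right y z y₀
      _ ≤ 2 * δ := by linarith
  calc dist (y₁ + A (y.2 - z.2)) y₀ ≤ dist y₁ y₀ + ‖A (y.2 - z.2)‖ := by
        rw [dist_eq_norm, dist_eq_norm, add_sub_right_comm]
        exact norm_add_le _ _
    _ ≤ dist y₁ y₀ + ‖A‖ * (2 * δ) := by gcongr; exact A.le_opNorm_of_le hsub
    _ < (2 * ‖A‖ + 1) * δ := by linarith

section Velocity

variable (n : ℕ) {M : Type*} [TopologicalSpace M] [ChartedSpace (Euc n) M]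

/-- The velocity at time `t` of the curve `γ`, defined on `s`, in an `n`-manifold. -/
def velocity (γ : ℝ → M) (s : Set ℝ) (t : ℝ) : TangentSpace (𝓡 n) (γ t) :=
  mfderivWithin 𝓘(ℝ, ℝ) (𝓡 n) γ s t (1 : ℝ)

end Velocity

namespace Foliation

section LiftCoord

variable {p n : ℕ} {M : Type*} [TopologicalSpace M] [ChartedSpace (Euc n) M]
  {F : Foliation p n M} {φ : OpenPartialHomeomorph M (Euc p × Euc (n - p))} {γ : ℝ → M} {a b : ℝ}

/-- The coordinates of the curve that starts at `y₁` and has the direction `A b'` where the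
transverse coordinates of `γ` have the direction `b'`. -/
def liftCoord (φ : OpenPartialHomeomorph M (Euc p × Euc (n - p)))
    (A : Euc (n - p) →L[ℝ] Euc p × Euc (n - p)) (γ : ℝ → M) (a : ℝ) (y₁ : Euc p × Euc (n - p))
    (t : ℝ) : Euc p × Euc (n - p) :=
  y₁ + A (transverse φ (γ t) - transverse φ (γ a))

variable {A : Euc (n - p) →L[ℝ] Euc p × Euc (n - p)} {y₁ : Euc p × Euc (n - p)}

theorem contMDiffOn_liftCoord (hφ : φ ∈ F.charts)
    (hγ : ContMDiffOn 𝓘(ℝ, ℝ) (𝓡 n) 1 γ (Set.Icc a b))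
    (hγφ : ∀ t ∈ Set.Icc a b, γ t ∈ φ.source) :
    ContMDiffOn 𝓘(ℝ, ℝ) 𝓘(ℝ, Euc p × Euc (n - p)) 1 (liftCoord φ A γ a y₁) (Set.Icc a b) := by
  have hcoord := ((F.contMDiffOn φ hφ).of_le (by simp)).comp hγ hγφ
  rw [contMDiffOn_iff_contDiffOn] at hcoord ⊢
  exact contDiffOn_const.add
    (A.contDiff.comp_contDiffOn ((contDiff_snd.comp_contDiffOn hcoord).sub contDiffOn_const))

theorem velocity_symm_liftCoord (hφ : φ ∈ F.charts) (hab : a < b)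
    (hγ : ContMDiffOn 𝓘(ℝ, ℝ) (𝓡 n) 1 γ (Set.Icc a b)) {t : ℝ} (ht : t ∈ Set.Icc a b)
    (hγt : γ t ∈ φ.source) (hyt : liftCoord φ A γ a y₁ t ∈ φ.target) :
    velocity n (φ.symm ∘ liftCoord φ A γ a y₁) (Set.Icc a b) t =
      mfderiv 𝓘(ℝ, Euc p × Euc (n - p)) (𝓡 n) φ.symm (liftCoord φ A γ a y₁ t)
        (A (dTransverse φ (γ t) (velocity n γ (Set.Icc a b) t))) := by
  have htransverse : HasFDerivWithinAt (transverse φ ∘ γ) _ (Set.Icc a b) t :=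
    hasMFDerivWithinAt_iff_hasFDerivWithinAt.1 <|
      (mdifferentiableAt_transverse hφ hγt).hasMFDerivAt.comp_hasMFDerivWithinAt t
        ((hγ t ht).mdifferentiableWithinAt (by simp)).hasMFDerivWithinAt
  have hcoord : HasFDerivWithinAt (liftCoord φ A γ a y₁) _ (Set.Icc a b) t :=
    (A.hasFDerivAt.comp_hasFDerivWithinAt t
      (htransverse.sub_const (transverse φ (γ a)))).const_add y₁
  have hlift := ((mdifferentiable_of_mem_charts hφ).mdifferentiableAt_symm
    hyt).hasMFDerivAt.comp_hasMFDerivWithinAt t (hasMFDerivWithinAt_iff_hasFDerivWithinAt.2 hcoord)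
  exact DFunLike.congr_fun
    (hlift.mfderivWithin (uniqueDiffOn_Icc hab t ht).uniqueMDiffWithinAt) (1 : ℝ)

end LiftCoord

section Parallel

variable {p n : ℕ} {M : Type*} [TopologicalSpace M] [ChartedSpace (Euc n) M]
  [IsManifold (𝓡 n) ∞ M] {F : Foliation p n M}
  {g : ContMDiffRiemannianMetric (𝓡 n) ∞ (Euc n) (fun x : M => TangentSpace (𝓡 n) x)}
  {φ : OpenPartialHomeomorph M (Euc p × Euc (n - p))} {γ γ₀ γ₁ : ℝ → M} {a b : ℝ}

/-- `γ₁` is a `C¹` curve on `[a, b]` that runs through the same leaves as `γ` and at the same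
transverse speed. -/
structure IsParallel (F : Foliation p n M)
    (g : ContMDiffRiemannianMetric (𝓡 n) ∞ (Euc n) (fun x : M => TangentSpace (𝓡 n) x))
    (γ γ₁ : ℝ → M) (a b : ℝ) : Prop where
  contMDiffOn : ContMDiffOn 𝓘(ℝ, ℝ) (𝓡 n) 1 γ₁ (Set.Icc a b)
  mem_leaf : ∀ t ∈ Set.Icc a b, γ₁ t ∈ F.leaf (γ t)
  normalSq_eq : ∀ t ∈ Set.Icc a b, F.normalSq g (γ₁ t) (velocity n γ₁ (Set.Icc a b) t) =
    F.normalSq g (γ t) (velocity n γ (Set.Icc a b) t)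

/-- The velocity of `γ` on `[a, b]` is at most twice as long as its component normal to the
leaves. -/
def IsAlmostNormal (F : Foliation p n M)
    (g : ContMDiffRiemannianMetric (𝓡 n) ∞ (Euc n) (fun x : M => TangentSpace (𝓡 n) x))
    (γ : ℝ → M) (a b : ℝ) : Prop :=
  ∀ t ∈ Set.Icc a b,
    g.inner (γ t) (velocity n γ (Set.Icc a b) t) (velocity n γ (Set.Icc a b) t) ≤
      4 * F.normalSq g (γ t) (velocity n γ (Set.Icc a b) t)

theorem isParallel_refl (hγ : ContMDiffOn 𝓘(ℝ, ℝ) (𝓡 n) 1 γ (Set.Icc a b)) :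
    F.IsParallel g γ γ a b :=
  ⟨hγ, fun t _ => F.mem_leaf_self (γ t), fun _ _ => rfl⟩

theorem IsParallel.trans (h₀ : F.IsParallel g γ₀ γ a b) (h : F.IsParallel g γ γ₁ a b) :
    F.IsParallel g γ₀ γ₁ a b where
  contMDiffOn := h.contMDiffOn
  mem_leaf t ht := F.leaf_eq_of_mem (h₀.mem_leaf t ht) ▸ h.mem_leaf t ht
  normalSq_eq t ht := (h.normalSq_eq t ht).trans (h₀.normalSq_eq t ht)

variable {A : Euc (n - p) →L[ℝ] Euc p × Euc (n - p)} {y₀ y₁ : Euc p × Euc (n - p)} {η : ℝ}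

theorem IsAdaptedBox.isParallel_lift (hA : F.IsAdaptedBox g φ y₀ η A) (hab : a < b)
    (hγ : ContMDiffOn 𝓘(ℝ, ℝ) (𝓡 n) 1 γ (Set.Icc a b))
    (hγφ : ∀ t ∈ Set.Icc a b, γ t ∈ φ.source ∧ φ (γ t) ∈ Metric.ball y₀ η)
    (hy₁ : y₁.2 = transverse φ (γ a))
    (hlift : ∀ t ∈ Set.Icc a b, liftCoord φ A γ a y₁ t ∈ Metric.ball y₀ η) :
    F.IsParallel g γ (φ.symm ∘ liftCoord φ A γ a y₁) a b ∧
      F.IsAlmostNormal g (φ.symm ∘ liftCoord φ A γ a y₁) a b := by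
  have hφ := hA.mem_charts
  have htarget := fun t ht => hA.ball_subset (hlift t ht)
  have hsource := fun t ht => φ.map_target (htarget t ht)
  have hball : ∀ t ∈ Set.Icc a b, φ (φ.symm (liftCoord φ A γ a y₁ t)) ∈ Metric.ball y₀ η :=
    fun t ht => (φ.right_inv (htarget t ht)).symm ▸ hlift t ht
  have hvelocity := fun t ht =>
    velocity_symm_liftCoord hφ hab hγ ht (hγφ t ht).1 (htarget t ht)
  have htransverse : ∀ t ∈ Set.Icc a b,
      transverse φ (φ.symm (liftCoord φ A γ a y₁ t)) = transverse φ (γ t) := by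
    intro t ht
    rw [transverse, φ.right_inv (htarget t ht), liftCoord, Prod.snd_add, hA.snd_apply, hy₁,
      add_sub_cancel]
  refine ⟨⟨((F.contMDiffOn_symm φ hφ).of_le (by simp)).comp
    (contMDiffOn_liftCoord hφ hγ fun t ht => (hγφ t ht).1) htarget, fun t ht => ?_,
    fun t ht => ?_⟩, fun t ht => ?_⟩
  · exact F.mem_leaf_of_transverse_eq hφ hA.ball_subset (hγφ t ht).1 (hsource t ht) (hγφ t ht).2
      (hball t ht) (htransverse t ht).symm
  · rw [hvelocity t ht]
    exact hA.normalSq_eq _ (hsource t ht) (hball t ht) _ (hγφ t ht).1 (hγφ t ht).2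
      (htransverse t ht) _ _
      ((dTransverse_mfderiv_symm hφ (htarget t ht) _).trans (hA.snd_apply _))
  · rw [hvelocity t ht]
    exact hA.chartNormSq_le _ (hlift t ht) _

theorem IsAdaptedBox.exists_isParallel (hA : F.IsAdaptedBox g φ y₀ η A) {δ : ℝ}
    (hδ : (2 * ‖A‖ + 1) * δ ≤ η) (hab : a < b)
    (hγ : ContMDiffOn 𝓘(ℝ, ℝ) (𝓡 n) 1 γ (Set.Icc a b))
    (hγδ : ∀ t ∈ Set.Icc a b, γ t ∈ φ.source ∧ dist (φ (γ t)) y₀ < δ) {x : M} (hx : x ∈ φ.source)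
    (hxδ : dist (φ x) y₀ < δ) (hγx : transverse φ (γ a) = transverse φ x) :
    ∃ γ₁ : ℝ → M, γ₁ a = x ∧ F.IsParallel g γ γ₁ a b ∧ F.IsAlmostNormal g γ₁ a b := by
  have hγa := (hγδ a ⟨le_rfl, hab.le⟩).2
  have hδη : δ ≤ η := by
    have : 0 ≤ 2 * ‖A‖ * δ := mul_nonneg (by positivity) (dist_nonneg.trans_lt hγa).le
    linarith
  refine ⟨φ.symm ∘ liftCoord φ A γ a (φ x), ?_, hA.isParallel_lift hab hγ
    (fun t ht => ⟨(hγδ t ht).1, (hγδ t ht).2.trans_le hδη⟩) hγx.symm fun t ht =>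
    (dist_add_apply_sub_lt A hxδ (hγδ t ht).2 hγa).trans_le hδ⟩
  simp only [Function.comp_apply, liftCoord, sub_self, map_zero, add_zero, φ.left_inv hx]

end Parallel

section Transport

open Manifold

variable {p n : ℕ} {M : Type*} [MetricSpace M] [ChartedSpace (Euc n) M]
  [RiemannianBundle (fun x : M => TangentSpace (𝓡 n) x)]

theorem edist_le_pathELength [IsRiemannianManifold (𝓡 n) M] {γ : ℝ → M} {a b t : ℝ}
    (hγ : ContMDiffOn 𝓘(ℝ, ℝ) (𝓡 n) 1 γ (Set.Icc a b)) (ht : t ∈ Set.Icc a b) :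
    edist (γ a) (γ t) ≤ pathELength (𝓡 n) γ a b := by
  rw [IsRiemannianManifold.out (I := 𝓡 n) (γ a) (γ t)]
  exact (riemannianEDist_le_pathELength (hγ.mono (Set.Icc_subset_Icc_right ht.2)) rfl rfl
    ht.1).trans (pathELength_mono le_rfl ht.2)

variable [IsManifold (𝓡 n) ∞ M]

/-- Curves of length less than `r` that start in `V` can be moved along the leaves, to every
starting point in `V` on the same plaque of `φ`. -/
def TransportsCurves (F : Foliation p n M)
    (g : ContMDiffRiemannianMetric (𝓡 n) ∞ (Euc n) (fun x : M => TangentSpace (𝓡 n) x))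
    (φ : OpenPartialHomeomorph M (Euc p × Euc (n - p))) (V : Set M) (r : ℝ) : Prop :=
  ∀ (γ : ℝ → M) (a b : ℝ), a < b → ContMDiffOn 𝓘(ℝ, ℝ) (𝓡 n) 1 γ (Set.Icc a b) →
    pathELength (𝓡 n) γ a b < ENNReal.ofReal r → γ a ∈ V →
      ∀ x ∈ V, transverse φ (γ a) = transverse φ x →
        ∃ γ₁ : ℝ → M, γ₁ a = x ∧ F.IsParallel g γ γ₁ a b ∧ F.IsAlmostNormal g γ₁ a b

variable {F : Foliation p n M}
  {g : ContMDiffRiemannianMetric (𝓡 n) ∞ (Euc n) (fun x : M => TangentSpace (𝓡 n) x)}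

theorem TransportsCurves.mono {φ : OpenPartialHomeomorph M (Euc p × Euc (n - p))} {V : Set M}
    {r s : ℝ} (h : F.TransportsCurves g φ V s) (hrs : r ≤ s) : F.TransportsCurves g φ V r :=
  fun γ a b hab hγ hlength => h γ a b hab hγ (hlength.trans_le (ENNReal.ofReal_le_ofReal hrs))

variable [IsRiemannianManifold (𝓡 n) M]

theorem exists_transportsCurves (hg : F.IsRiemannian g) (z₀ : M) :
    ∃ φ ∈ F.charts, ∃ ρ > 0, Metric.ball z₀ ρ ⊆ φ.source ∧
      F.TransportsCurves g φ (Metric.ball z₀ ρ) ρ := by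
  obtain ⟨φ, hz₀, η, hη, A, hA⟩ := exists_isAdaptedBox hg z₀
  have hpos : 0 < 2 * ‖A‖ + 1 := by positivity
  have hδ : 0 < η / (2 * ‖A‖ + 1) := by positivity
  obtain ⟨ρ, hρ, hball⟩ := Metric.eventually_nhds_iff_ball.1
    ((φ.open_source.eventually_mem hz₀).and
      ((φ.continuousAt hz₀).eventually (Metric.ball_mem_nhds _ hδ)))
  have hsub : Metric.ball z₀ (ρ / 2) ⊆ Metric.ball z₀ ρ := Metric.ball_subset_ball (by linarith)
  refine ⟨φ, hA.mem_charts, ρ / 2, by positivity, fun z hz => (hball z (hsub hz)).1, ?_⟩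
  intro γ a b hab hγ hlength hγa x hx hγx
  have hγball : ∀ t ∈ Set.Icc a b, γ t ∈ Metric.ball z₀ ρ := by
    intro t ht
    have hdist := (edist_le_pathELength hγ ht).trans_lt hlength
    rw [edist_lt_ofReal, dist_comm] at hdist
    have := dist_triangle (γ t) (γ a) z₀
    rw [Metric.mem_ball] at hγa ⊢
    linarith
  exact hA.exists_isParallel (mul_div_cancel₀ η hpos.ne').le hab hγ
    (fun t ht => hball _ (hγball t ht)) (hball x (hsub hx)).1 (hball x (hsub hx)).2 hγx

theorem exists_uniform_transportsCurves [CompactSpace M] (hg : F.IsRiemannian g) :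
    ∃ r > 0, ∀ x : M, ∃ φ ∈ F.charts, ∃ V : Set M, IsOpen V ∧ x ∈ V ∧ V ⊆ φ.source ∧
      F.TransportsCurves g φ V r := by
  choose φ hφ ρ hρ hsource htransport using exists_transportsCurves hg
  obtain ⟨T, hT⟩ := isCompact_univ.elim_nhds_subcover (fun z => Metric.ball z (ρ z))
    (fun z _ => Metric.ball_mem_nhds z (hρ z))
  obtain ⟨r, hrT, hr⟩ := (((Finset.eventually_all T).2 fun z _ => Ioc_mem_nhdsGT (hρ z)).and
    self_mem_nhdsWithin).exists
  refine ⟨r, hr, fun x => ?_⟩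
  obtain ⟨z, hz, hxz⟩ := Set.mem_iUnion₂.1 (hT.2 (Set.mem_univ x))
  exact ⟨φ z, hφ z, _, Metric.isOpen_ball, hxz, hsource z, (htransport z).mono (hrT z hz).2⟩

end Transport

end Foliation

/-! ### Distances between leaves -/

theorem infEDist_le_infEDist_add {X : Type*} [PseudoEMetricSpace X] {A B : Set X} {c : ℝ≥0∞}
    (h : ∀ y ∈ A, Metric.infEDist y B ≤ c) (x : X) :
    Metric.infEDist x B ≤ Metric.infEDist x A + c := by
  rw [← tsub_le_iff_right, Metric.le_infEDist]
  exact fun y hy => tsub_le_iff_right.2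
    (Metric.infEDist_le_edist_add_infEDist.trans (by gcongr; exact h y hy))

section Length

open Manifold

variable {n : ℕ} {M : Type*} [TopologicalSpace M] [ChartedSpace (Euc n) M]
  [RiemannianBundle (fun x : M => TangentSpace (𝓡 n) x)] {γ γ₁ : ℝ → M}

theorem pathELength_le_mul {a b K : ℝ} (hK : 0 ≤ K)
    (h : ∀ t ∈ Set.Icc a b, ‖velocity n γ₁ (Set.Icc a b) t‖ ≤ K * ‖velocity n γ (Set.Icc a b) t‖) :
    pathELength (𝓡 n) γ₁ a b ≤ ENNReal.ofReal K * pathELength (𝓡 n) γ a b := by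
  rw [pathELength_eq_lintegral_mfderivWithin_Icc, pathELength_eq_lintegral_mfderivWithin_Icc,
    ← MeasureTheory.lintegral_const_mul' _ _ ENNReal.ofReal_ne_top]
  refine MeasureTheory.setLIntegral_mono' measurableSet_Icc fun t ht => ?_
  rw [← ofReal_norm, ← ofReal_norm, ← ENNReal.ofReal_mul hK]
  exact ENNReal.ofReal_le_ofReal (h t ht)

theorem exists_subdivision (hγ : pathELength (𝓡 n) γ 0 1 ≠ ⊤) {r : ℝ≥0∞} (hr : r ≠ 0) :
    ∃ N : ℕ, 0 < N ∧ ∀ i < N, pathELength (𝓡 n) γ ((i : ℝ) / N) (((i + 1 : ℕ) : ℝ) / N) < r := by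
  rw [pathELength_eq_lintegral_mfderiv_Icc] at hγ
  obtain ⟨δ, hδ, hsmall⟩ := MeasureTheory.exists_pos_setLIntegral_lt_of_measure_lt hγ hr
  obtain ⟨N, hN⟩ := ENNReal.exists_inv_nat_lt hδ.ne'
  have hN0 : 0 < N := Nat.pos_of_ne_zero fun h => by simp [h] at hN
  have hN0' : (0 : ℝ) < N := Nat.cast_pos.2 hN0
  refine ⟨N, hN0, fun i hi => ?_⟩
  set J := Set.Icc ((i : ℝ) / N) (((i + 1 : ℕ) : ℝ) / N) with hJ
  have hJsub : J ⊆ Set.Icc 0 1 :=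
    Set.Icc_subset_Icc (by positivity) ((div_le_one hN0').2 (by exact_mod_cast hi))
  have hJvolume : MeasureTheory.volume J = (N : ℝ≥0∞)⁻¹ := by
    rw [Real.volume_Icc, ← sub_div, Nat.cast_succ, add_sub_cancel_left, one_div,
      ENNReal.ofReal_inv_of_pos hN0', ENNReal.ofReal_natCast]
  have hJlt := hsmall J (by
    rwa [MeasureTheory.Measure.restrict_apply measurableSet_Icc, Set.inter_eq_left.2 hJsub,
      hJvolume])
  rwa [MeasureTheory.Measure.restrict_restrict measurableSet_Icc, Set.inter_eq_left.2 hJsub,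
    hJ, ← pathELength_eq_lintegral_mfderiv_Icc] at hJlt

end Length

namespace Foliation

section Equidistance

open Manifold

/-- The metric `g` is comparable, up to the factor `C`, to the Riemannian metric of `M`. -/
def IsComparableMetric {n : ℕ} {M : Type*} [TopologicalSpace M] [ChartedSpace (Euc n) M]
    [IsManifold (𝓡 n) ∞ M] [RiemannianBundle (fun x : M => TangentSpace (𝓡 n) x)]
    (g : ContMDiffRiemannianMetric (𝓡 n) ∞ (Euc n) (fun x : M => TangentSpace (𝓡 n) x))
    (C : ℝ) : Prop :=
  ∀ (x : M) (v : TangentSpace (𝓡 n) x),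
    1 / C * inner ℝ v v ≤ g.inner x v v ∧ g.inner x v v ≤ C * inner ℝ v v

/-- `F` is Riemannian for a metric that is comparable, up to the factor `C`, to that of `M`. -/
def IsComparablyRiemannian {p n : ℕ} {M : Type*} [TopologicalSpace M] [ChartedSpace (Euc n) M]
    [IsManifold (𝓡 n) ∞ M] [RiemannianBundle (fun x : M => TangentSpace (𝓡 n) x)]
    (F : Foliation p n M) (C : ℝ) : Prop :=
  ∃ g : ContMDiffRiemannianMetric (𝓡 n) ∞ (Euc n) (fun x : M => TangentSpace (𝓡 n) x),
    IsComparableMetric g C ∧ F.IsRiemannian g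

variable {p n : ℕ} {M : Type*} [MetricSpace M] [ChartedSpace (Euc n) M]
  [IsManifold (𝓡 n) ∞ M] [RiemannianBundle (fun x : M => TangentSpace (𝓡 n) x)]
  {F : Foliation p n M}
  {g : ContMDiffRiemannianMetric (𝓡 n) ∞ (Euc n) (fun x : M => TangentSpace (𝓡 n) x)}
  {γ γ₁ : ℝ → M} {a b C : ℝ}

theorem IsParallel.pathELength_le (h : F.IsParallel g γ γ₁ a b) (hγ₁ : F.IsAlmostNormal g γ₁ a b)
    (hg : IsComparableMetric g C) (hC : 0 < C) :
    pathELength (𝓡 n) γ₁ a b ≤ ENNReal.ofReal (2 * C) * pathELength (𝓡 n) γ a b := by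
  refine pathELength_le_mul (by positivity) fun t ht => ?_
  set v := velocity n γ (Set.Icc a b) t
  set v₁ := velocity n γ₁ (Set.Icc a b) t
  have hsq : 1 / C * ‖v₁‖ ^ 2 ≤ 4 * (C * ‖v‖ ^ 2) := by
    rw [← real_inner_self_eq_norm_sq, ← real_inner_self_eq_norm_sq]
    calc 1 / C * inner ℝ v₁ v₁ ≤ g.inner (γ₁ t) v₁ v₁ := (hg _ _).1
      _ ≤ 4 * F.normalSq g (γ₁ t) v₁ := hγ₁ t ht
      _ = 4 * F.normalSq g (γ t) v := by rw [h.normalSq_eq t ht]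
      _ ≤ 4 * g.inner (γ t) v v := by gcongr; exact normalSq_le _ _
      _ ≤ 4 * (C * inner ℝ v v) := by gcongr; exact (hg _ _).2
  rw [one_div, inv_mul_le_iff₀ hC] at hsq
  exact (sq_le_sq₀ (norm_nonneg _) (by positivity)).1 (by linarith)

variable [IsRiemannianManifold (𝓡 n) M] [CompactSpace M]

theorem exists_infEDist_leaf_le_of_short_curve (hF : F.IsRiemannian g)
    (hg : IsComparableMetric g C) (hC : 1 ≤ C) :
    ∃ r > 0, ∀ (γ : ℝ → M) (a b : ℝ), a < b → ContMDiffOn 𝓘(ℝ, ℝ) (𝓡 n) 1 γ (Set.Icc a b) →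
      pathELength (𝓡 n) γ a b < r → ∀ x ∈ F.leaf (γ a), Metric.infEDist x (F.leaf (γ b)) ≤
        ENNReal.ofReal (2 * C) * pathELength (𝓡 n) γ a b := by
  obtain ⟨r, hr, htransport⟩ := exists_uniform_transportsCurves hF
  refine ⟨ENNReal.ofReal r / ENNReal.ofReal (2 * C), ENNReal.div_pos (by simpa using hr)
    ENNReal.ofReal_ne_top, fun γ a b hab hγ hlength x hx => ?_⟩
  have hlength' : ENNReal.ofReal (2 * C) * pathELength (𝓡 n) γ a b < ENNReal.ofReal r := by
    rw [mul_comm]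
    exact ENNReal.mul_lt_of_lt_div hlength
  let S : Set M := {x | ∃ γ₁ : ℝ → M, γ₁ a = x ∧ F.IsParallel g γ γ₁ a b ∧
    pathELength (𝓡 n) γ₁ a b ≤ ENNReal.ofReal (2 * C) * pathELength (𝓡 n) γ a b}
  have hγS : γ a ∈ S := ⟨γ, rfl, isParallel_refl hγ,
    le_mul_of_one_le_left' (ENNReal.one_le_ofReal.2 (by linarith))⟩
  have hS : F.leaf (γ a) ⊆ S := by
    refine F.leaf_subset_of_plaque_invariant (fun x => ?_) hγS
    obtain ⟨φ, hφ, V, hV, hxV, hVs, htransportV⟩ := htransport x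
    refine ⟨φ, hφ, V, hV, hxV, hVs, ?_⟩
    rintro _ hz w hw hzw ⟨γ₁, rfl, hparallel₁, hlength₁⟩
    obtain ⟨γ₂, hγ₂, hparallel₂, hnormal₂⟩ := htransportV γ₁ a b hab hparallel₁.contMDiffOn
      (hlength₁.trans_lt hlength') hz w hw hzw
    have hparallel := hparallel₁.trans hparallel₂
    exact ⟨γ₂, hγ₂, hparallel, hparallel.pathELength_le hnormal₂ hg (by linarith)⟩
  obtain ⟨γ₁, rfl, hparallel, hlength₁⟩ := hS hx
  have hb : b ∈ Set.Icc a b := ⟨hab.le, le_rfl⟩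
  exact (Metric.infEDist_le_edist_of_mem (hparallel.mem_leaf b hb)).trans
    ((edist_le_pathELength hparallel.contMDiffOn hb).trans hlength₁)

theorem IsComparablyRiemannian.infEDist_leaf_le_pathELength (hF : F.IsComparablyRiemannian C)
    (hC : 1 ≤ C) (hγ : ContMDiffOn 𝓘(ℝ, ℝ) (𝓡 n) 1 γ (Set.Icc 0 1))
    (hlength : pathELength (𝓡 n) γ 0 1 ≠ ⊤) {x : M} (hx : x ∈ F.leaf (γ 0)) :
    Metric.infEDist x (F.leaf (γ 1)) ≤ ENNReal.ofReal (2 * C) * pathELength (𝓡 n) γ 0 1 := by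
  obtain ⟨g, hg, hFg⟩ := hF
  obtain ⟨r, hr, hshort⟩ := exists_infEDist_leaf_le_of_short_curve hFg hg hC
  obtain ⟨N, hN0, hN⟩ := exists_subdivision hlength hr.ne'
  have hN0' : (0 : ℝ) < N := Nat.cast_pos.2 hN0
  have hprefix : ∀ i ≤ N, Metric.infEDist x (F.leaf (γ ((i : ℝ) / N))) ≤
      ENNReal.ofReal (2 * C) * pathELength (𝓡 n) γ 0 ((i : ℝ) / N) := by
    intro i
    induction i with
    | zero => exact fun _ => by simpa using Metric.infEDist_zero_of_mem hx
    | succ i ih =>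
      intro hi
      have h0 : (0 : ℝ) ≤ (i : ℝ) / N := by positivity
      have hlt : (i : ℝ) / N < ((i + 1 : ℕ) : ℝ) / N := by gcongr; exact i.lt_succ_self
      have h1 : ((i + 1 : ℕ) : ℝ) / N ≤ 1 := (div_le_one hN0').2 (by exact_mod_cast hi)
      refine (infEDist_le_infEDist_add (hshort γ _ _ hlt
        (hγ.mono (Set.Icc_subset_Icc h0 h1)) (hN i hi)) x).trans ?_
      rw [← pathELength_add h0 hlt.le, mul_add]
      gcongr
      exact ih (Nat.le_of_succ_le hi)
  simpa only [div_self hN0'.ne'] using hprefix N le_rfl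

theorem IsComparablyRiemannian.infEDist_leaf_le_edist (hF : F.IsComparablyRiemannian C)
    (hC : 1 ≤ C) {x x₀ : M} (hx : x ∈ F.leaf x₀) (y₀ : M) :
    Metric.infEDist x (F.leaf y₀) ≤ ENNReal.ofReal (2 * C) * edist x₀ y₀ := by
  have hC0 : ENNReal.ofReal (2 * C) ≠ 0 := (ENNReal.ofReal_pos.2 (by linarith)).ne'
  rw [← ENNReal.div_le_iff' hC0 ENNReal.ofReal_ne_top]
  refine le_of_forall_gt fun s hs => ?_
  rw [IsRiemannianManifold.out (I := 𝓡 n) x₀ y₀] at hs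
  obtain ⟨γ, rfl, rfl, hγ, hlength⟩ := exists_lt_of_riemannianEDist_lt hs
  exact (ENNReal.div_le_of_le_mul' (hF.infEDist_leaf_le_pathELength hC hγ hlength.ne_top
    hx)).trans_lt hlength

end Equidistance

section LeafSpaceMetric

variable {p n : ℕ} {M : Type*} [PseudoEMetricSpace M] [ChartedSpace (Euc n) M]
  {F : Foliation p n M}

theorem setDist_comm (L L' : F.LeafSpace) : F.setDist L L' = F.setDist L' L := by
  have hle (L L' : F.LeafSpace) : F.setDist L L' ≤ F.setDist L' L :=
    le_iInf₂ fun x y => le_iInf₂ fun hx hy =>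
      iInf₂_le_of_le y x (iInf₂_le_of_le hy hx (edist_comm y x).le)
  exact le_antisymm (hle _ _) (hle _ _)

theorem rho_comm (L L' : F.LeafSpace) : F.rho L L' = F.rho L' L := by
  have hle (L L' : F.LeafSpace) : F.rho L L' ≤ F.rho L' L := by
    refine le_iInf₂ fun m S => le_iInf₂ fun h0 hm => ?_
    refine iInf₂_le_of_le m (fun i => S (m - i)) (iInf₂_le_of_le (by simpa using hm)
      (by simpa using h0) (le_of_eq ?_))
    rw [← Finset.sum_range_reflect (fun i => F.setDist (S i) (S (i + 1)))]
    refine Finset.sum_congr rfl fun i hi => ?_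
    have him := Finset.mem_range.1 hi
    beta_reduce
    rw [setDist_comm, show m - (i + 1) = m - 1 - i by omega, show m - i = m - 1 - i + 1 by omega]
  exact le_antisymm (hle _ _) (hle _ _)

theorem rho_mk_le (x y : M) : F.rho ⟦x⟧ ⟦y⟧ ≤ edist x y := by
  refine iInf₂_le_of_le 1 (fun i => if i = 0 then ⟦x⟧ else ⟦y⟧)
    (iInf₂_le_of_le (by simp) (by simp) ?_)
  simp only [Finset.sum_range_one, if_true]
  exact iInf₂_le_of_le x y (iInf₂_le_of_le rfl (by simp) le_rfl)

theorem capacity_rho_le (r : ℝ) : capacity F.rho r ≤ capacity (fun x y : M => edist x y) r := by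
  refine capacity_le_capacity_of_map Quotient.out fun L L' hne hdisj =>
    ⟨fun h => hne (Quotient.out_injective h), Set.disjoint_left.2 fun z hz hz' => ?_⟩
  have hmem (L : F.LeafSpace) (h : edist L.out z < ENNReal.ofReal r) : ⟦z⟧ ∈ eBall F.rho L r := by
    have hle := F.rho_mk_le L.out z
    rw [Quotient.out_eq] at hle
    exact hle.trans_lt h
  exact Set.disjoint_left.1 hdisj (hmem L hz) (hmem L' hz')

theorem capacity_rho_ne_zero [Nonempty M] (r : ℝ) : capacity F.rho r ≠ 0 := by
  have : Nonempty F.LeafSpace := ⟨⟦Classical.arbitrary M⟧⟩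
  exact capacity_pos.ne'

theorem capacity_rho_ne_top [CompactSpace M] {r : ℝ} (hr : 0 < r) : capacity F.rho r ≠ ⊤ :=
  ne_top_of_le_ne_top (capacity_ne_top hr) (capacity_rho_le r)

theorem infEDist_preimage_le_mul_setDist {K : ℝ≥0∞} (hK : K ≠ 0) (hK' : K ≠ ⊤)
    (h : ∀ x x₀ y₀ : M, x ∈ F.leaf x₀ → Metric.infEDist x (F.leaf y₀) ≤ K * edist x₀ y₀)
    (x : M) (L' : F.LeafSpace) :
    Metric.infEDist x (Quotient.mk F.leafSetoid ⁻¹' {L'}) ≤ K * F.setDist ⟦x⟧ L' := by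
  rw [← ENNReal.div_le_iff' hK hK']
  refine le_iInf₂ fun x₀ y₀ => le_iInf₂ fun hx₀ hy₀ => ENNReal.div_le_of_le_mul' ?_
  have hsub : F.leaf y₀ ⊆ Quotient.mk F.leafSetoid ⁻¹' {L'} := fun y hy =>
    ((F.mk_eq_mk_iff_mem_leaf.2 hy).symm.trans hy₀ :)
  exact (Metric.infEDist_anti hsub).trans (h x x₀ y₀ (F.mk_eq_mk_iff_mem_leaf.1 hx₀))

theorem infEDist_preimage_le_mul_rho {K : ℝ≥0∞} (hK : K ≠ 0) (hK' : K ≠ ⊤)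
    (h : ∀ x x₀ y₀ : M, x ∈ F.leaf x₀ → Metric.infEDist x (F.leaf y₀) ≤ K * edist x₀ y₀)
    (x : M) (L' : F.LeafSpace) :
    Metric.infEDist x (Quotient.mk F.leafSetoid ⁻¹' {L'}) ≤ K * F.rho ⟦x⟧ L' := by
  rw [← ENNReal.div_le_iff' hK hK']
  refine le_iInf₂ fun m S => le_iInf₂ fun h0 hm => ENNReal.div_le_of_le_mul' ?_
  subst hm
  induction m with
  | zero =>
    rw [Metric.infEDist_zero_of_mem (s := Quotient.mk F.leafSetoid ⁻¹' {S 0}) h0.symm]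
    exact zero_le
  | succ m ih =>
    rw [Finset.sum_range_succ, mul_add]
    refine (infEDist_le_infEDist_add (fun y hy => ?_) x).trans (add_le_add_left ih _)
    rw [← show ⟦y⟧ = S m from hy]
    exact infEDist_preimage_le_mul_setDist hK hK' h y _

end LeafSpaceMetric

end Foliation

/-! ### Capacity of foliated manifolds -/

namespace Foliation

section Capacity

variable {p n : ℕ} {M : Type*} [MetricSpace M] [ChartedSpace (Euc n) M]
  [RiemannianBundle (fun x : M => TangentSpace (𝓡 n) x)] {F : Foliation p n M} {C r : ℝ}

theorem capacity_rho_mul_le_capacity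
    (hdisj : ∀ x : M, ∀ a b : F.leaf x,
      Disjoint (eBall (F.edistOnLeaf x) a r) (eBall (F.edistOnLeaf x) b r) →
        Disjoint (eBall edist (a : M) r) (eBall edist (b : M) r))
    {a : ℝ≥0∞} (ha : ∀ x : M, a ≤ capacity (F.edistOnLeaf x) r) :
    capacity F.rho r * a ≤ (capacity (fun x y : M => edist x y) r : ℝ≥0∞) :=
  capacity_mul_le_capacity (f := Quotient.mk F.leafSetoid) (L := fun L => F.leaf L.out)
    (fun L _ hx => (F.mk_eq_mk_iff_mem_leaf.2 hx).symm.trans L.out_eq) F.rho_mk_le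
    (fun L => hdisj L.out) fun L => ha L.out

variable [IsRiemannianManifold (𝓡 n) M]

theorem edist_le_edistOnLeaf (x : M) (a b : F.leaf x) : edist (a : M) b ≤ F.edistOnLeaf x a b := by
  refine le_iInf₂ fun γ hγ => le_iInf₂ fun h0 h1 => le_iInf fun _ => ?_
  have hle := edist_le_pathELength hγ (t := 1) ⟨zero_le_one, le_rfl⟩
  rwa [h0, h1] at hle

variable [IsManifold (𝓡 n) ∞ M] [CompactSpace M]

theorem IsComparablyRiemannian.capacity_le_capacity_rho_mul (hF : F.IsComparablyRiemannian C)
    (hC : 1 ≤ C) (hr : 0 < r) {b : ℝ≥0∞} (hb : ∀ x : M, capacity (F.edistOnLeaf x) r ≤ b)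
    (hbtop : b ≠ ⊤) :
    capacity (fun x y : M => edist x y) ((4 * C + 2) * r) ≤ capacity F.rho r * b := by
  have hK : 0 < 2 * C := by linarith
  rw [show 4 * C + 2 = 2 * (2 * C) + 2 by ring]
  exact capacity_le_capacity_mul (f := Quotient.mk F.leafSetoid) (L := fun L => F.leaf L.out)
    (fun x => F.mk_eq_mk_iff_mem_leaf.1 (Quotient.out_eq _)) (fun L => edist_le_edistOnLeaf L.out)
    rho_comm hK hr
    (infEDist_preimage_le_mul_rho (ENNReal.ofReal_pos.2 hK).ne' ENNReal.ofReal_ne_top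
      fun _ _ y₀ hx => hF.infEDist_leaf_le_edist hC hx y₀)
    (capacity_rho_ne_top hr) (fun L => hb L.out) hbtop

end Capacity

section Separation

variable {p p' n n' : ℕ} {d c θ C r : ℝ}
  {M : Type*} [MetricSpace M] [CompactSpace M] [Nonempty M] [ChartedSpace (Euc n) M]
  [IsManifold (𝓡 n) ∞ M] [RiemannianBundle (fun x : M => TangentSpace (𝓡 n) x)]
  [IsRiemannianManifold (𝓡 n) M] {F : Foliation p n M}
  {M' : Type*} [MetricSpace M'] [CompactSpace M'] [Nonempty M'] [ChartedSpace (Euc n') M']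
  [RiemannianBundle (fun x : M' => TangentSpace (𝓡 n') x)] {F' : Foliation p' n' M'}

theorem capacity_rho_mul_le_of_ghDist_lt (hc : 0 < c) (hC : 1 ≤ C)
    (hleaf : ∀ x, CapacityEstimate (F.edistOnLeaf x) p 1 c θ) (hF : F.IsComparablyRiemannian C)
    (hleaf' : ∀ x, CapacityEstimate (F'.edistOnLeaf x) p' 1 c θ)
    {V : ℝ≥0∞} (hM' : CapacityEstimate (fun x y : M' => edist x y) n' V c θ)
    (hr : 0 < r) (hrθ : (16 * C + 8) * r < θ)
    (hdisj : ∀ x : M', ∀ a b : F'.leaf x,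
      Disjoint (eBall (F'.edistOnLeaf x) a r) (eBall (F'.edistOnLeaf x) b r) →
        Disjoint (eBall edist (a : M') r) (eBall edist (b : M') r))
    (hgh : GromovHausdorff.ghDist M M' < (4 * C + 2) * r) :
    capacity F'.rho r * ENNReal.ofReal (1 / (c * r ^ p')) ≤
      ENNReal.ofReal (c ^ 2 * (16 * C + 8) ^ n') *
        (capacity F.rho r * ENNReal.ofReal (c / r ^ p)) := by
  have hrθ' : r < θ := by nlinarith
  calc capacity F'.rho r * ENNReal.ofReal (1 / (c * r ^ p'))
      ≤ (capacity (fun x y : M' => edist x y) r : ℝ≥0∞) :=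
        capacity_rho_mul_le_capacity hdisj fun x => by simpa using (hleaf' x r hr hrθ').1
    _ ≤ ENNReal.ofReal (c ^ 2 * (16 * C + 8) ^ n') *
          capacity (fun x y : M' => edist x y) ((16 * C + 8) * r) := by
        simpa [hr.ne'] using hM'.capacity_le hc hr hrθ' (by positivity) hrθ
    _ ≤ ENNReal.ofReal (c ^ 2 * (16 * C + 8) ^ n') *
          capacity (fun x y : M => edist x y) ((4 * C + 2) * r) := by
        gcongr
        rw [show (16 * C + 8) * r = 4 * ((4 * C + 2) * r) by ring]
        exact capacity_le_of_ghDist_lt hgh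
    _ ≤ _ := by
        gcongr
        exact hF.capacity_le_capacity_rho_mul hC hr
          (fun x => by simpa using (hleaf x r hr hrθ').2) ENNReal.ofReal_ne_top

end Separation

end Foliation

theorem pow_le_mul_pow_of_mul_le {N N' : ℕ∞} (hN : N ≠ 0) (hN' : N ≠ ⊤) (hNN' : N ≤ N')
    {c D r : ℝ} (hc : 0 < c) (hD : 0 ≤ D) (hr : 0 < r) {p p' : ℕ}
    (h : N' * ENNReal.ofReal (1 / (c * r ^ p')) ≤
      ENNReal.ofReal D * (N * ENNReal.ofReal (c / r ^ p))) :
    r ^ p ≤ c ^ 2 * D * r ^ p' := by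
  have hmul : N * ENNReal.ofReal (1 / (c * r ^ p')) ≤ N * ENNReal.ofReal (D * (c / r ^ p)) :=
    calc N * ENNReal.ofReal (1 / (c * r ^ p')) ≤ N' * ENNReal.ofReal (1 / (c * r ^ p')) := by
          gcongr
      _ ≤ _ := h
      _ = _ := by rw [mul_left_comm, ENNReal.ofReal_mul hD]
  rw [ENNReal.mul_le_mul_iff_right (by simpa using hN) (by simpa using hN'),
    ENNReal.ofReal_le_ofReal_iff (by positivity), ← mul_div_assoc,
    div_le_div_iff₀ (by positivity) (by positivity)] at hmul
  linarith

theorem exists_pos_and_mul_pow_lt_pow {d θ a b : ℝ} (hd : 0 < d) (hθ : 0 < θ) {p p' : ℕ}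
    (hp : p < p') :
    ∃ r : ℝ, 0 < r ∧ r < d ∧ a * r < θ ∧ b * r ^ p' < r ^ p := by
  have hmul (u : ℝ) : Filter.Tendsto (fun r : ℝ => u * r) (𝓝[>] 0) (𝓝 0) := by
    simpa using ((continuous_const_mul u).tendsto 0).mono_left nhdsWithin_le_nhds
  have hpow : Filter.Tendsto (fun r : ℝ => b * r ^ (p' - p)) (𝓝[>] 0) (𝓝 0) := by
    have hpow : Continuous fun r : ℝ => b * r ^ (p' - p) := by fun_prop
    simpa [(Nat.sub_pos_of_lt hp).ne'] using (hpow.tendsto 0).mono_left nhdsWithin_le_nhds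
  obtain ⟨r, hr, hrd, hrθ, hrb⟩ := (eventually_mem_nhdsWithin.and
    ((Filter.Tendsto.eventually_lt_const hd (by simpa using hmul 1)).and
      (((hmul a).eventually_lt_const hθ).and (hpow.eventually_lt_const one_pos)))).exists
  have hr : 0 < r := hr
  refine ⟨r, hr, hrd, hrθ, ?_⟩
  calc b * r ^ p' = b * r ^ (p' - p) * r ^ p := by
        rw [mul_assoc, ← pow_add, Nat.sub_add_cancel hp.le]
    _ < r ^ p := mul_lt_of_lt_one_left (by positivity) hrb

theorem theorem4p1_general {d c θ C : ℝ} (hd : 0 < d) (hc : 0 < c) (hθ : 0 < θ) (hC : 1 ≤ C)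
    {p p' : ℕ} (hp : p < p') (n n' : ℕ) :
    ∃ ε : ℝ, 0 < ε ∧
      ∀ (M : Type u) [MetricSpace M] [CompactSpace M] [Nonempty M]
        [ChartedSpace (Euc n) M] [IsManifold (𝓡 n) ∞ M]
        [RiemannianBundle (fun x : M => TangentSpace (𝓡 n) x)]
        [IsRiemannianManifold (𝓡 n) M]
        (F : Foliation p n M)
        (M' : Type v) [MetricSpace M'] [CompactSpace M'] [Nonempty M']
        [ChartedSpace (Euc n') M']
        [RiemannianBundle (fun x : M' => TangentSpace (𝓡 n') x)]
        (F' : Foliation p' n' M') (V : ℝ≥0∞),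
        (∀ x, CapacityEstimate (F.edistOnLeaf x) p 1 c θ) →
        F.IsComparablyRiemannian C →
        (∀ x, CapacityEstimate (F'.edistOnLeaf x) p' 1 c θ) →
        CapacityEstimate (fun x y : M' => edist x y) n' V c θ →
        (∀ x : M', ∀ a b : F'.leaf x, ∀ r : ℝ, r < d →
          Disjoint (eBall (F'.edistOnLeaf x) a r) (eBall (F'.edistOnLeaf x) b r) →
            Disjoint (eBall edist (a : M') r) (eBall edist (b : M') r)) →
        Broader F'.rho F.rho → ε < GromovHausdorff.ghDist M M' := by
  obtain ⟨r, hr, hrd, hrθ, hrp⟩ := exists_pos_and_mul_pow_lt_pow (a := 16 * C + 8)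
    (b := c ^ 2 * (c ^ 2 * (16 * C + 8) ^ n')) hd hθ hp
  refine ⟨r, hr, ?_⟩
  intro M _ _ _ _ _ _ _ F M' _ _ _ _ _ F' V hleaf hF hleaf' hM' hdisj hbroader
  by_contra! hgh
  have hcapacity := Foliation.capacity_rho_mul_le_of_ghDist_lt hc hC hleaf hF hleaf' hM' hr hrθ
    (fun x a b => hdisj x a b r hrd) (hgh.trans_lt (by nlinarith))
  exact hrp.not_ge (pow_le_mul_pow_of_mul_le (F.capacity_rho_ne_zero r)
    (F.capacity_rho_ne_top hr) (hbroader r hr) hc (by positivity) hr hcapacity)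

theorem Foliation.InClass.capacityEstimate_leaf {p n : ℕ} {M : Type*} [MetricSpace M]
    [ChartedSpace (Euc n) M] [IsManifold (𝓡 n) ∞ M]
    [RiemannianBundle (fun x : M => TangentSpace (𝓡 n) x)] {F : Foliation p n M} {d C : ℝ}
    (h : F.InClass d C) (x : M) :
    CapacityEstimate (F.edistOnLeaf x) p 1 (C * C) (1 / C) := by
  obtain ⟨c, θ, hc, hcC, hθ, hest⟩ := h.leaf_capacity x
  exact (hest.mono (by linarith) hcC hθ).of_volume (by linarith) (h.leaf_volume x).1
    (h.leaf_volume x).2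

theorem Foliation.InClass.capacityEstimate {p n : ℕ} {M : Type*} [MetricSpace M]
    [ChartedSpace (Euc n) M] [IsManifold (𝓡 n) ∞ M]
    [RiemannianBundle (fun x : M => TangentSpace (𝓡 n) x)] {F : Foliation p n M} {d C : ℝ}
    (h : F.InClass d C) :
    CapacityEstimate (fun x y : M => edist x y) n (manifoldVolume n M) (C * C) (1 / C) := by
  obtain ⟨c, θ, hc, hcC, hθ, hest⟩ := h.capacity
  exact hest.mono (by linarith) (by nlinarith) hθ

end

theorem theorem4p1 (d C : ℝ) (hd : 0 < d) (hC : 1 ≤ C) (p p' n n' : ℕ) (hp : p < p')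
    (hn : n ≤ n') :
    ∃ ε : ℝ, 0 < ε ∧
      ∀ (M : Type u) [MetricSpace M] [CompactSpace M] [ConnectedSpace M]
        [ChartedSpace (Euc n) M] [IsManifold (𝓡 n) ∞ M]
        [RiemannianBundle (fun x : M => TangentSpace (𝓡 n) x)]
        [IsContMDiffRiemannianBundle (𝓡 n) ∞ (Euc n) (fun x : M => TangentSpace (𝓡 n) x)]
        [IsRiemannianManifold (𝓡 n) M]
        (F : Foliation p n M)
        (M' : Type v) [MetricSpace M'] [CompactSpace M'] [ConnectedSpace M']
        [ChartedSpace (Euc n') M'] [IsManifold (𝓡 n') ∞ M']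
        [RiemannianBundle (fun x : M' => TangentSpace (𝓡 n') x)]
        [IsContMDiffRiemannianBundle (𝓡 n') ∞ (Euc n') (fun x : M' => TangentSpace (𝓡 n') x)]
        [IsRiemannianManifold (𝓡 n') M']
        (F' : Foliation p' n' M'),
        F.InClass d C → F'.InClass d C → Broader F'.rho F.rho →
          ε < GromovHausdorff.ghDist M M' := by
  have hC0 : 0 < C := by linarith
  obtain ⟨ε, hε, hsep⟩ := theorem4p1_general hd (mul_pos hC0 hC0) (one_div_pos.2 hC0) hC hp n n'
  exact ⟨ε, hε, fun M _ _ _ _ _ _ _ _ F M' _ _ _ _ _ _ _ _ F' h h' => hsep M F M' F' _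
    h.capacityEstimate_leaf h.exists_riemannian h'.capacityEstimate_leaf h'.capacityEstimate
    h'.disjoint_balls⟩
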